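/- Let $n\ge 1$, let $\lambda_1,\dots,\lambda_n$ be nonzero reals with $\lambda_i^2\neq\lambda_j^2$ for $i\ne j$, let $c_1,\dots,c_n\in\mathbb R$, and put $a_i=\exp(\lambda_i\xi+\eta/\lambda_i+c_i)$. Let $\omega^{(\lambda_s\dots\lambda_{s+j-1})}(\xi,\eta)$ be the sine-Gordon solitons of the Bianchi lattice over the zero seed: $0$ for $j=0$, $2\arctan a_s$ for $j=1$, and, continuing the arctangent continuously, $$\tan\frac{\omega^{(\lambda_s\dots\lambda_{s+j+1})}-\omega^{(\lambda_{s+1}\dots\lambda_{s+j})}}2=\frac{\lambda_s+\lambda_{s+j+1}}{\lambda_s-\lambda_{s+j+1}}\tan\frac{\omega^{(\lambda_s\dots\lambda_{s+j})}-\omega^{(\lambda_{s+1}\dots\lambda_{s+j+1})}}2 .$$ Write $\omega^{[j]}=\omega^{(\lambda_1\dots\lambda_j)}$ and $\bar\omega^{[j]}=\omega^{(\lambda_2\dots\lambda_{j+1})}$. A $j$-soliton solution of the constant astigmatism equation (CAE) $z_{yy}+(1/z)_{xx}+2=0$ is a triple $(x,y,g)$ of associated potentials of the pair $\omega=\bar\omega^{[j-1]}$,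 $\omega'=\omega^{[j]}$. That is, $\omega,\omega'$ solve $\omega_{\xi\eta}=\frac12\sin2\omega$; they satisfy the Bäcklund system $\omega'_\xi=\omega_\xi+\lambda_1\sin(\omega'+\omega)$, $\omega'_\eta=-\omega_\eta+\frac1{\lambda_1}\sin(\omega'-\omega)$; $g$ has no zero; and $$g_\xi=\lambda_1 g\cos(\omega'+\omega),\quad g_\eta=\tfrac1{\lambda_1}g\cos(\omega'-\omega),\quad x_\xi=\lambda_1 g\sin(\omega'+\omega),\quad x_\eta=\tfrac1{\lambda_1}g\sin(\omega'-\omega),$$ $$y_\xi=\frac{\lambda_1\sin(\omega'+\omega)}{g},\quad y_\eta=-\frac{\sin(\omega'-\omega)}{\lambda_1 g}.$$ Let $\varphi^{[j]}=1-2\,\partial_\xi\partial_\eta\ln|\det M|$, where $M$ is the $j\times j$ matrix $M_{pq}=\frac1{\lambda_p+\lambda_q}\bigl(\sqrt{a_pa_q}+\frac1{\sqrt{a_pa_q}}\bigr)$. Let $\bar\varphi^{[j]}$ and $\bar M$ arise from $\varphi^{[j]}$ and $M$ by increasing all indices of $\lambda$ and $a$ by one. Put $A^{[j]}=2\bar\varphi^{[j]}\varphi^{[j]}$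 and $B^{[j]}=2\sqrt{((\bar\varphi^{[j]})^2-1)((\varphi^{[j]})^2-1)}$. For $1\le j\le n-1$ let $S^{[j]}$ be the $4\times4$ matrix whose only nonzero entries are $$S^{[j]}_{11}=\frac{\lambda_{j+1}\lambda_1}{\lambda_{j+1}^2-\lambda_1^2},\qquad S^{[j]}_{13}=\frac{\lambda_{j+1}^2\lambda_1^2}{\lambda_1^2-\lambda_{j+1}^2}\cdot\frac{\sqrt{2-A^{[j]}-B^{[j]}}}{\lambda_1^2+\lambda_{j+1}^2-\lambda_{j+1}\lambda_1\sqrt{2+A^{[j]}+B^{[j]}}},$$ $$S^{[j]}_{22}=\frac{\lambda_{j+1}^2-\lambda_1^2}{\lambda_{j+1}\lambda_1},\qquad S^{[j]}_{24}=-\sqrt{2-A^{[j]}-B^{[j]}},$$ $$S^{[j]}_{33}=\frac1{S^{[j]}_{44}}=\frac{-\lambda_{j+1}\lambda_1}{\lambda_1^2+\lambda_{j+1}^2-\lambda_{j+1}\lambda_1\sqrt{2+A^{[j]}+B^{[j]}}}.$$ Here, at each point, the real root in $B^{[j]}$ is taken with the sign of $\sin2\bar\omega^{[j]}\sin2\omega^{[j]}$,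 the root $\sqrt{2-A^{[j]}-B^{[j]}}$ with the sign of $\sin(\bar\omega^{[j]}-\omega^{[j]})$, and $\sqrt{2+A^{[j]}+B^{[j]}}$ with the sign of $\cos(\bar\omega^{[j]}-\omega^{[j]})$ (so they are the usual nonnegative roots wherever these three quantities are nonnegative). Then the following hold. 1. Everywhere $\det M\neq0$ and $\cos2\omega^{[j]}=\varphi^{[j]}$ for $0\le j\le n$; likewise, the same holds with all indices shifted, in particular $\det\bar M\ne0$ and $\cos2\bar\omega^{[j]}=\bar\varphi^{[j]}$ for $j\le n-1$. 2. For every $k_1\in\mathbb R$, $x_1=\frac{a_1^2-1}{a_1^2+1}$, $y_1=\lambda_1\xi-\frac{\eta}{\lambda_1}+k_1$, $g_1=\frac{2a_1}{1+a_1^2}$ is a one-soliton solution of the CAE. 3. The $n$-soliton solutions of the CAE are given by $$\begin{pmatrix}x^{[n]}\\y^{[n]}\\g^{[n]}\\1/g^{[n]}\end{pmatrix}=S^{[n-1]}S^{[n-2]}\cdots S^{[1]}\begin{pmatrix}x_1\\y_1\\g_1\\1/g_1\end{pmatrix}.$$ The data of item 2 are mapped to an $n$-soliton solution, and a triple $(x^{[n]},y^{[n]},g^{[n]})$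 is an $n$-soliton solution if and only if it arises by this formula from some one-soliton solution $(x_1,y_1,g_1)$. -/

import Mathlib

noncomputable section

namespace CAE

/-- The exponentials `a_i = exp (lam_i ξ + η / lam_i + c_i)`. -/
def expo (lam c : ℕ → ℝ) (i : ℕ) (ξ η : ℝ) : ℝ :=
  Real.exp (lam i * ξ + η / lam i + c i)

/-- The continuous angle function `θ ↦ L` with `tan L = k tan θ` and `L = 0` at `θ = 0`
(for `k ≠ 0`). It is `arctan (k * tan θ)` for `|θ| < π / 2`, continued through the poles of `tan`;
these properties are `supAngle_spec`, `continuous_supAngle` and `supAngle_zero`. -/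
def supAngle (k θ : ℝ) : ℝ :=
  Real.sign k * θ +
    Real.arctan ((k - Real.sign k) * (Real.sin θ * Real.cos θ) /
      (Real.cos θ ^ 2 + |k| * Real.sin θ ^ 2))

theorem supAngle_zero (k : ℝ) : supAngle k 0 = 0 := by
  simp [supAngle]

theorem supAngle_den_pos {k : ℝ} (hk : k ≠ 0) (θ : ℝ) :
    0 < Real.cos θ ^ 2 + |k| * Real.sin θ ^ 2 := by
  have hk' : 0 < |k| := abs_pos.mpr hk
  have h := Real.sin_sq_add_cos_sq θ
  rcases eq_or_ne (Real.cos θ) 0 with hc | hc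
  · have : Real.sin θ ^ 2 = 1 := by rw [hc] at h; linarith
    rw [hc, this]; simpa using hk'
  · have := mul_nonneg hk'.le (sq_nonneg (Real.sin θ))
    have := pow_pos (abs_pos.mpr hc) 2
    rw [sq_abs] at this
    linarith

theorem continuous_supAngle {k : ℝ} (hk : k ≠ 0) : Continuous (supAngle k) := by
  unfold supAngle
  refine (continuous_const.mul continuous_id).add (Real.continuous_arctan.comp ?_)
  exact Continuous.div (by fun_prop) (by fun_prop) (fun θ => (supAngle_den_pos hk θ).ne')

/-- `tan (supAngle k θ) = k * tan θ`, with denominators cleared. -/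
theorem supAngle_spec {k : ℝ} (hk : k ≠ 0) (θ : ℝ) :
    Real.sin (supAngle k θ) * Real.cos θ = k * Real.sin θ * Real.cos (supAngle k θ) := by
  have hD := supAngle_den_pos hk θ
  unfold supAngle
  set x := (k - Real.sign k) * (Real.sin θ * Real.cos θ) /
      (Real.cos θ ^ 2 + |k| * Real.sin θ ^ 2) with hx
  have hx' : x * (Real.cos θ ^ 2 + |k| * Real.sin θ ^ 2) =
      (k - Real.sign k) * (Real.sin θ * Real.cos θ) := by
    rw [hx]; exact div_mul_cancel₀ _ hD.ne.symm
  rw [Real.sin_add, Real.cos_add, Real.sin_arctan, Real.cos_arctan]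
  have hs : 0 < √(1 + x ^ 2) := Real.sqrt_pos.mpr (by positivity)
  rcases lt_or_gt_of_ne hk with h | h
  · rw [Real.sign_of_neg h] at hx' ⊢
    rw [abs_of_neg h] at hx'
    simp only [neg_one_mul, Real.sin_neg, Real.cos_neg]
    field_simp
    linear_combination hx'
  · rw [Real.sign_of_pos h] at hx' ⊢
    rw [abs_of_pos h] at hx'
    simp only [one_mul]
    field_simp
    linear_combination hx'

/-- `omega lam c s j` is the sine-Gordon solution `ω^(lam_s lam_{s+1} … lam_{s+j-1})` of the Bianchi
lattice over the zero seed: `0` for `j = 0`, the one-soliton `2 arctan a_s` for `j = 1`, and then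
the superposition formula
`tan ((ω₁₂ - ω) / 2) = (lam₁ + lam₂) / (lam₁ - lam₂) * tan ((ω₁ - ω₂) / 2)` with
`lam₁ = lam_s`, `lam₂ = lam_{s+j+1}`, `ω = ω^(lam_{s+1} … lam_{s+j})`,
`ω₁ = ω^(lam_s … lam_{s+j})`, `ω₂ = ω^(lam_{s+1} … lam_{s+j+1})`, solved for `ω₁₂` by a
continuous branch of the arctangent. Thus `ω^[j] = omega lam c 1 j` and its barred version, in
which all indices are increased by one, is `omega lam c 2 j`. -/
def omega (lam c : ℕ → ℝ) : ℕ → ℕ → ℝ → ℝ → ℝ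
  | _, 0 => fun _ _ => 0
  | s, 1 => fun ξ η => 2 * Real.arctan (expo lam c s ξ η)
  | s, j + 2 => fun ξ η =>
      omega lam c (s + 1) j ξ η +
        2 * supAngle ((lam s + lam (s + j + 1)) / (lam s - lam (s + j + 1)))
          ((omega lam c s (j + 1) ξ η - omega lam c (s + 1) (j + 1) ξ η) / 2)

/-- The `j × j` matrix with entries
`(√(a_p a_q) + 1 / √(a_p a_q)) / (lam_p + lam_q)`, where `p, q` run over `s, …, s + j - 1`.
The matrix `M` is the case `s = 1` and the shifted matrix is the case `s = 2`. -/
def cauchyMatrix (lam c : ℕ → ℝ) (s j : ℕ) (ξ η : ℝ) : Matrix (Fin j) (Fin j) ℝ :=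
  Matrix.of fun p q =>
    1 / (lam (s + p) + lam (s + q)) *
      (√(expo lam c (s + p) ξ η * expo lam c (s + q) ξ η) +
        1 / √(expo lam c (s + p) ξ η * expo lam c (s + q) ξ η))

/-- `1 - 2 ∂_ξ ∂_η ln det M` for the matrix above: `φ^[j] = phi lam c 1 j`, and its barred version
is `phi lam c 2 j`. -/
def phi (lam c : ℕ → ℝ) (s j : ℕ) (ξ η : ℝ) : ℝ :=
  1 - 2 * deriv (fun ξ' => deriv (fun η' => Real.log (cauchyMatrix lam c s j ξ' η').det) η) ξ

/-- `ω` is a (twice continuously differentiable) solution of `ω_{ξη} = (1/2) sin 2ω`. -/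
def IsSineGordonSolution (ω : ℝ → ℝ → ℝ) : Prop :=
  ContDiff ℝ 2 (Function.uncurry ω) ∧
    ∀ ξ η, deriv (fun η' => deriv (fun ξ' => ω ξ' η') ξ) η = 1 / 2 * Real.sin (2 * ω ξ η)

/-- `ω'` is a Bäcklund transformation of `ω` with parameter `l`. -/
def IsBacklundTransform (l : ℝ) (ω ω' : ℝ → ℝ → ℝ) : Prop :=
  (∀ ξ η, deriv (fun t => ω' t η) ξ =
    deriv (fun t => ω t η) ξ + l * Real.sin (ω' ξ η + ω ξ η)) ∧
  (∀ ξ η, deriv (fun t => ω' ξ t) η =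
    -deriv (fun t => ω ξ t) η + 1 / l * Real.sin (ω' ξ η - ω ξ η))

/-- `x, y, g` are associated potentials of the pair `ω, ω'` of sine-Gordon solutions, where `ω'` is
a Bäcklund transformation of `ω` with parameter `l`. -/
structure IsAssociatedPotentials (l : ℝ) (ω ω' : ℝ → ℝ → ℝ) (x y g : ℝ → ℝ → ℝ) : Prop where
  solution : IsSineGordonSolution ω
  solution' : IsSineGordonSolution ω'
  backlund : IsBacklundTransform l ω ω'
  g_ne_zero : ∀ ξ η, g ξ η ≠ 0
  g_xi : ∀ ξ η,
    HasDerivAt (fun t => g t η) (g ξ η * l * Real.cos (ω' ξ η + ω ξ η)) ξ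
  g_eta : ∀ ξ η,
    HasDerivAt (fun t => g ξ t) (g ξ η * (1 / l) * Real.cos (ω' ξ η - ω ξ η)) η
  x_xi : ∀ ξ η,
    HasDerivAt (fun t => x t η) (l * g ξ η * Real.sin (ω' ξ η + ω ξ η)) ξ
  x_eta : ∀ ξ η,
    HasDerivAt (fun t => x ξ t) (1 / l * g ξ η * Real.sin (ω' ξ η - ω ξ η)) η
  y_xi : ∀ ξ η,
    HasDerivAt (fun t => y t η) (l * Real.sin (ω' ξ η + ω ξ η) / g ξ η) ξ
  y_eta : ∀ ξ η,
    HasDerivAt (fun t => y ξ t) (-(Real.sin (ω' ξ η - ω ξ η) / (l * g ξ η))) η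

/-- A `j`-soliton solution of the constant astigmatism equation (`j ≥ 1`): a triple of associated
potentials of the pair formed by the barred `(j - 1)`-soliton and the `j`-soliton `ω^[j]`. -/
def IsSolitonSolution (lam c : ℕ → ℝ) (j : ℕ) (x y g : ℝ → ℝ → ℝ) : Prop :=
  IsAssociatedPotentials (lam 1) (omega lam c 2 (j - 1)) (omega lam c 1 j) x y g

/-- The explicit one-soliton data. -/
def g₁ (lam c : ℕ → ℝ) (ξ η : ℝ) : ℝ :=
  2 * expo lam c 1 ξ η / (1 + expo lam c 1 ξ η ^ 2)

/-- The explicit one-soliton data. -/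
def x₁ (lam c : ℕ → ℝ) (ξ η : ℝ) : ℝ :=
  (expo lam c 1 ξ η ^ 2 - 1) / (expo lam c 1 ξ η ^ 2 + 1)

/-- The explicit one-soliton data; `k₁` is an arbitrary constant. -/
def y₁ (lam : ℕ → ℝ) (k₁ : ℝ) (ξ η : ℝ) : ℝ :=
  lam 1 * ξ - η / lam 1 + k₁

/-- The square root of `r` that has the sign of `t`. -/
def signedSqrt (t r : ℝ) : ℝ := Real.sign t * √r

/-- `A^[j]`. -/
def A (lam c : ℕ → ℝ) (j : ℕ) (ξ η : ℝ) : ℝ :=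
  2 * phi lam c 2 j ξ η * phi lam c 1 j ξ η

/-- `B^[j]`; the root has the sign of `sin 2ω̄^[j] * sin 2ω^[j]`. -/
def B (lam c : ℕ → ℝ) (j : ℕ) (ξ η : ℝ) : ℝ :=
  2 * signedSqrt (Real.sin (2 * omega lam c 2 j ξ η) * Real.sin (2 * omega lam c 1 j ξ η))
    ((phi lam c 2 j ξ η ^ 2 - 1) * (phi lam c 1 j ξ η ^ 2 - 1))

/-- `√(2 - A^[j] - B^[j])`; the root has the sign of `sin (ω̄^[j] - ω^[j])`. -/
def rootMinus (lam c : ℕ → ℝ) (j : ℕ) (ξ η : ℝ) : ℝ :=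
  signedSqrt (Real.sin (omega lam c 2 j ξ η - omega lam c 1 j ξ η))
    (2 - A lam c j ξ η - B lam c j ξ η)

/-- `√(2 + A^[j] + B^[j])`; the root has the sign of `cos (ω̄^[j] - ω^[j])`. -/
def rootPlus (lam c : ℕ → ℝ) (j : ℕ) (ξ η : ℝ) : ℝ :=
  signedSqrt (Real.cos (omega lam c 2 j ξ η - omega lam c 1 j ξ η))
    (2 + A lam c j ξ η + B lam c j ξ η)

/-- The entry `S^[j]_{33}`. -/
def S33 (lam c : ℕ → ℝ) (j : ℕ) (ξ η : ℝ) : ℝ :=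
  -(lam (j + 1) * lam 1) /
    (lam 1 ^ 2 + lam (j + 1) ^ 2 - lam (j + 1) * lam 1 * rootPlus lam c j ξ η)

/-- The matrix `S^[j]`. -/
def S (lam c : ℕ → ℝ) (j : ℕ) (ξ η : ℝ) : Matrix (Fin 4) (Fin 4) ℝ :=
  !![lam (j + 1) * lam 1 / (lam (j + 1) ^ 2 - lam 1 ^ 2), 0,
      lam (j + 1) ^ 2 * lam 1 ^ 2 / (lam 1 ^ 2 - lam (j + 1) ^ 2) *
        (rootMinus lam c j ξ η /
          (lam 1 ^ 2 + lam (j + 1) ^ 2 - lam (j + 1) * lam 1 * rootPlus lam c j ξ η)), 0;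
    0, (lam (j + 1) ^ 2 - lam 1 ^ 2) / (lam (j + 1) * lam 1), 0, -rootMinus lam c j ξ η;
    0, 0, S33 lam c j ξ η, 0;
    0, 0, 0, 1 / S33 lam c j ξ η]

/-- The ordered product `S^[m] * S^[m-1] * ⋯ * S^[1]` (the identity for `m = 0`). -/
def prodS (lam c : ℕ → ℝ) : ℕ → ℝ → ℝ → Matrix (Fin 4) (Fin 4) ℝ
  | 0, _, _ => 1
  | m + 1, ξ, η => S lam c (m + 1) ξ η * prodS lam c m ξ η

/-- The column vector `(x, y, g, 1/g)` at a point. -/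
def stateVec (x y g : ℝ → ℝ → ℝ) (ξ η : ℝ) : Fin 4 → ℝ :=
  ![x ξ η, y ξ η, g ξ η, 1 / g ξ η]

end CAE

end

noncomputable section

namespace CAE

open Real

/-! ### The angle function `supAngle` -/

/-! Everything is carried by one Bianchi quadrilateral: Bäcklund transforms `ω₁`, `ω₂` of `ω` with
parameters `l`, `m`, and their superposition `ω₁₂`. With `D = ω₁ - ω₂`, `F = ω₁₂ - ω` and `h =
quadDen l m D = l² + m² - 2 l m cos D > 0`, the superposition formula makes `cos F` and `sin F`
rational in `cos D`, `sin D` with denominator `h` (`quadDen_mul_cos`, `quadDen_mul_sin`). Hence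
permutability (`backlund_left`, `backlund_right`), and the logarithmic derivatives of `h` are
differences of the cosines governing the potentials `g` on opposite edges (`den_xi`, `den_eta`).

Potentials of the edge `ω, ω₁` therefore pass to the edge `ω₂, ω₁₂` by `g' = -(m l / h) g`, while
`x` and `y` acquire explicit terms in `sin (ω₂ - ω₁)`. The formulas are algebraically invertible, so
transport works in both directions (`associated_right`, `associated_left`). The signed roots in `S`
are `2 sin` and `2 cos` of `ω̄ - ω`, so `S` is exactly this transport, and induction along the
lattice gives the product and its converse.

For the determinants, `M` solves `ΛM + MΛ = P Pᵀ`, where `P` has rows `(√a, 1/√a)`. Adjoining an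
index multiplies the dressing matrix `1 - Pᵀ M⁻¹ (Λ + z)⁻¹ P` by an elementary factor, which is a
reflection at `z = 0` (`dress_fromRows`). Composing such factors reproduces the superposition
formula (`superposition_refl`): at `z = 0` the dressing matrix is a rotation or reflection with
angle `ω`, no determinant vanishes, and the determinants around a quadrilateral are linked by the
factor `h / (l + m)²` (`lattice_step`). Thus ratios of neighbouring determinants have the
`η`-logarithmic derivative of `1/g`; telescoping gives `∂_ξ ∂_η ln |det M| = sin² ω`, that is `φ =
cos 2ω`. -/

theorem supAngle_cos_sq {k : ℝ} (hk : k ≠ 0) (θ : ℝ) :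
    (cos θ ^ 2 + k ^ 2 * sin θ ^ 2) * cos (supAngle k θ) ^ 2 = cos θ ^ 2 := by
  have h := supAngle_spec hk θ
  have h1 := sin_sq_add_cos_sq (supAngle k θ)
  linear_combination -(sin (supAngle k θ) * cos θ + k * sin θ * cos (supAngle k θ)) * h
    + cos θ ^ 2 * h1

theorem supAngle_sin_mul_cos {k : ℝ} (hk : k ≠ 0) (θ : ℝ) :
    (cos θ ^ 2 + k ^ 2 * sin θ ^ 2) * (sin (supAngle k θ) * cos (supAngle k θ)) =
      k * sin θ * cos θ := by
  have h := supAngle_spec hk θ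
  have h1 := sin_sq_add_cos_sq (supAngle k θ)
  linear_combination (cos θ * cos (supAngle k θ) - k * sin θ * sin (supAngle k θ)) * h
    + k * sin θ * cos θ * h1

theorem contDiff_supAngle {k : ℝ} (hk : k ≠ 0) {n : WithTop ℕ∞} : ContDiff ℝ n (supAngle k) := by
  unfold supAngle
  refine (contDiff_const.mul contDiff_id).add (contDiff_arctan.comp ?_)
  refine ContDiff.div ?_ ?_ (fun θ => (supAngle_den_pos hk θ).ne')
  · exact contDiff_const.mul (contDiff_sin.mul contDiff_cos)
  · exact (contDiff_cos.pow 2).add (contDiff_const.mul (contDiff_sin.pow 2))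

theorem cos_sq_add_mul_sin_sq_pos {k : ℝ} (hk : k ≠ 0) (θ : ℝ) :
    0 < cos θ ^ 2 + k ^ 2 * sin θ ^ 2 := by
  have := supAngle_den_pos (pow_ne_zero 2 hk) θ
  rwa [abs_of_nonneg (sq_nonneg k)] at this

/-- Implicit differentiation of `sin L cos θ = k sin θ cos L`, which avoids the explicit arctangent
and the sign of `k`. -/
theorem hasDerivAt_supAngle {k : ℝ} (hk : k ≠ 0) (θ : ℝ) :
    HasDerivAt (supAngle k) (k / (cos θ ^ 2 + k ^ 2 * sin θ ^ 2)) θ := by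
  have hd : HasDerivAt (supAngle k) (deriv (supAngle k) θ) θ :=
    ((contDiff_supAngle hk (n := 1)).differentiable (by norm_num) θ).hasDerivAt
  have e1 := hd.sin.mul (hasDerivAt_cos θ)
  have e2 := ((hasDerivAt_sin θ).const_mul k).mul hd.cos
  have heq : (fun t => sin (supAngle k t)) * cos =
      (fun t => k * sin t) * (fun t => cos (supAngle k t)) :=
    funext fun t => supAngle_spec hk t
  rw [heq] at e1
  have e := e1.unique e2
  have h := supAngle_spec hk θ
  have h1 := sin_sq_add_cos_sq (supAngle k θ)
  have h2 := sin_sq_add_cos_sq θ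
  have hpos := cos_sq_add_mul_sin_sq_pos hk θ
  have : deriv (supAngle k) θ = k / (cos θ ^ 2 + k ^ 2 * sin θ ^ 2) := by
    rw [eq_div_iff hpos.ne']
    set L := deriv (supAngle k) θ
    set S := sin (supAngle k θ)
    set C := cos (supAngle k θ)
    set s := sin θ
    set c := cos θ
    -- `C c + k s S` is the coefficient of the derivative in the differentiated relation;
    -- multiplying by it once more gives the stated denominator.
    have key : (C * c + k * s * S) ^ 2 = c ^ 2 + k ^ 2 * s ^ 2 := by
      linear_combination (c ^ 2 + k ^ 2 * s ^ 2) * h1 - (S * c - k * s * C) * h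
    have key2 : (C * c + k * s * S) * (k * c * C + s * S) = k := by
      linear_combination (s * C - k * c * S) * h + k * (s ^ 2 + c ^ 2) * h1 + k * h2
    linear_combination -L * key + key2 + (C * c + k * s * S) * e
  rwa [this] at hd

/-! ### The Bianchi quadrilateral, pointwise -/

/-- The quantity `l² + m² - 2 l m cos D` attached to a Bianchi quadrilateral. -/
def quadDen (l m D : ℝ) : ℝ := l ^ 2 + m ^ 2 - 2 * l * m * cos D

theorem sq_ne_sq_sub {l m : ℝ} (h : l ^ 2 ≠ m ^ 2) : l - m ≠ 0 := by
  intro h0; exact h (by rw [sub_eq_zero.mp h0])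

theorem sq_ne_sq_add {l m : ℝ} (h : l ^ 2 ≠ m ^ 2) : l + m ≠ 0 := by
  intro h0; exact h (by rw [eq_neg_of_add_eq_zero_left h0]; ring)

/-- The half-angle form exhibits a sum of squares, which is positive because neither `l - m` nor `l
+ m` vanishes. -/
theorem quadDen_eq (l m θ : ℝ) :
    quadDen l m (2 * θ) = (l - m) ^ 2 * cos θ ^ 2 + (l + m) ^ 2 * sin θ ^ 2 := by
  have h := sin_sq_add_cos_sq θ
  rw [quadDen, cos_two_mul]
  linear_combination -(l + m) ^ 2 * h

theorem quadDen_eq_mul {l m : ℝ} (h : l ^ 2 ≠ m ^ 2) (θ : ℝ) :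
    quadDen l m (2 * θ) =
      (l - m) ^ 2 * (cos θ ^ 2 + ((l + m) / (l - m)) ^ 2 * sin θ ^ 2) := by
  have h1 := sq_ne_sq_sub h
  rw [quadDen_eq]
  field_simp

theorem quadDen_pos {l m : ℝ} (h : l ^ 2 ≠ m ^ 2) (D : ℝ) : 0 < quadDen l m D := by
  have h1 := sq_ne_sq_sub h
  have h2 := sq_ne_sq_add h
  rw [show D = 2 * (D / 2) by ring, quadDen_eq_mul h]
  exact mul_pos (by positivity) (cos_sq_add_mul_sin_sq_pos (div_ne_zero h2 h1) _)

/-- Together with `quadDen_mul_sin`, this is the tangent superposition formula in rational form: no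
poles and no choice of branch remain. -/
theorem quadDen_mul_cos {l m : ℝ} (h : l ^ 2 ≠ m ^ 2) (D : ℝ) :
    quadDen l m D * cos (2 * supAngle ((l + m) / (l - m)) (D / 2)) =
      (l ^ 2 + m ^ 2) * cos D - 2 * l * m := by
  obtain ⟨θ, rfl⟩ : ∃ θ, D = 2 * θ := ⟨D / 2, by ring⟩
  have h1 := sq_ne_sq_sub h
  have hk := div_ne_zero (sq_ne_sq_add h) h1
  have e1 := supAngle_cos_sq hk θ
  have h2 := sin_sq_add_cos_sq θ
  rw [mul_div_cancel_left₀ θ two_ne_zero, cos_two_mul, cos_two_mul]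
  have := quadDen_eq_mul h θ
  have e3 := quadDen_eq l m θ
  linear_combination 2 * (l - m) ^ 2 * e1 - e3 - (l + m) ^ 2 * h2
    + 2 * cos (supAngle ((l + m) / (l - m)) θ) ^ 2 * this

theorem quadDen_mul_sin {l m : ℝ} (h : l ^ 2 ≠ m ^ 2) (D : ℝ) :
    quadDen l m D * sin (2 * supAngle ((l + m) / (l - m)) (D / 2)) =
      (l ^ 2 - m ^ 2) * sin D := by
  obtain ⟨θ, rfl⟩ : ∃ θ, D = 2 * θ := ⟨D / 2, by ring⟩
  have h1 := sq_ne_sq_sub h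
  have hk := div_ne_zero (sq_ne_sq_add h) h1
  have e1 := supAngle_sin_mul_cos hk θ
  rw [mul_div_cancel_left₀ θ two_ne_zero, sin_two_mul, sin_two_mul]
  have := quadDen_eq_mul h θ
  have e3 : (l + m) / (l - m) * (l - m) = l + m := div_mul_cancel₀ _ h1
  linear_combination 2 * (l - m) ^ 2 * e1 + 2 * (l - m) * sin θ * cos θ * e3
    + 2 * sin (supAngle ((l + m) / (l - m)) θ) * cos (supAngle ((l + m) / (l - m)) θ) * this

theorem hasDerivAt_two_mul_supAngle {l m : ℝ} (h : l ^ 2 ≠ m ^ 2) {D : ℝ → ℝ} {D' t : ℝ}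
    (hD : HasDerivAt D D' t) :
    HasDerivAt (fun t => 2 * supAngle ((l + m) / (l - m)) (D t / 2))
      ((l ^ 2 - m ^ 2) * D' / quadDen l m (D t)) t := by
  have h1 := sq_ne_sq_sub h
  have hk := div_ne_zero (sq_ne_sq_add h) h1
  have e := ((hasDerivAt_supAngle hk (D t / 2)).comp t (hD.div_const 2)).const_mul 2
  refine e.congr_deriv ?_
  have e2 := quadDen_eq_mul h (D t / 2)
  rw [mul_div_cancel₀ (D t) two_ne_zero] at e2
  rw [e2]
  have hp := (cos_sq_add_mul_sin_sq_pos hk (D t / 2)).ne'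
  generalize cos (D t / 2) ^ 2 + ((l + m) / (l - m)) ^ 2 * sin (D t / 2) ^ 2 = X at *
  field_simp
  ring

theorem hasDerivAt_quadDen {l m : ℝ} {D : ℝ → ℝ} {D' t : ℝ} (hD : HasDerivAt D D' t) :
    HasDerivAt (fun t => quadDen l m (D t)) (2 * l * m * sin (D t) * D') t := by
  unfold quadDen
  refine ((hD.cos.const_mul (2 * l * m)).const_sub (l ^ 2 + m ^ 2)).congr_deriv ?_
  ring

end CAE

namespace CAE

open Real

/-! ### Trigonometric identities in a Bianchi quadrilateral -/

section Trig

variable {l m D F : ℝ}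

/-- Dictionary for this section: `D = ω₁ - ω₂`, `F = ω₁₂ - ω`, `a = ω₁ + ω`, `b = ω₁ - ω`. Then `a -
D = ω₂ + ω`, `a + F = ω₁₂ + ω₁`, `a - D + F = ω₁₂ + ω₂`, and likewise `b - D = ω₂ - ω`, `F - b = ω₁₂
- ω₁`, `F - (b - D) = ω₁₂ - ω₂`. The identities with `a` serve the `ξ`-equations, those with `b` the
`η`-equations. -/
theorem quad_sin_add_left (hC : quadDen l m D * cos F = (l ^ 2 + m ^ 2) * cos D - 2 * l * m)
    (hS : quadDen l m D * sin F = (l ^ 2 - m ^ 2) * sin D) (a : ℝ) :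
    quadDen l m D * (l * sin a + m * sin (a + F)) =
      (l ^ 2 - m ^ 2) * (l * sin a - m * sin (a - D)) := by
  rw [sin_add, sin_sub]
  unfold quadDen at *
  linear_combination m * sin a * hC + m * cos a * hS

theorem quad_sin_add_right (hC : quadDen l m D * cos F = (l ^ 2 + m ^ 2) * cos D - 2 * l * m)
    (hS : quadDen l m D * sin F = (l ^ 2 - m ^ 2) * sin D) (a : ℝ) :
    quadDen l m D * (m * sin (a - D) + l * sin (a - D + F)) =
      (l ^ 2 - m ^ 2) * (l * sin a - m * sin (a - D)) := by
  have h := sin_sq_add_cos_sq D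
  rw [sin_add (a - D), sin_sub, cos_sub]
  unfold quadDen at *
  linear_combination l * (sin a * cos D - cos a * sin D) * hC
    + l * (cos a * cos D + sin a * sin D) * hS + l * (l ^ 2 - m ^ 2) * sin a * h

theorem quad_cos_add (hC : quadDen l m D * cos F = (l ^ 2 + m ^ 2) * cos D - 2 * l * m)
    (hS : quadDen l m D * sin F = (l ^ 2 - m ^ 2) * sin D) (a : ℝ) :
    quadDen l m D * (l * (cos a - cos (a - D + F))) =
      2 * l * m * sin D * (l * sin a - m * sin (a - D)) := by
  have h := sin_sq_add_cos_sq D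
  rw [cos_add (a - D), sin_sub, cos_sub]
  unfold quadDen at *
  linear_combination -l * (cos a * cos D + sin a * sin D) * hC
    + l * (sin a * cos D - cos a * sin D) * hS - l * (l ^ 2 + m ^ 2) * cos a * h

theorem quad_sin_sub_left (hC : quadDen l m D * cos F = (l ^ 2 + m ^ 2) * cos D - 2 * l * m)
    (hS : quadDen l m D * sin F = (l ^ 2 - m ^ 2) * sin D) (b : ℝ) :
    quadDen l m D * (l * sin (F - b) - m * sin b) =
      (l ^ 2 - m ^ 2) * (m * sin b - l * sin (b - D)) := by
  rw [sin_sub, sin_sub]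
  unfold quadDen at *
  linear_combination -l * sin b * hC + l * cos b * hS

theorem quad_sin_sub_right (hC : quadDen l m D * cos F = (l ^ 2 + m ^ 2) * cos D - 2 * l * m)
    (hS : quadDen l m D * sin F = (l ^ 2 - m ^ 2) * sin D) (b : ℝ) :
    quadDen l m D * (m * sin (F - (b - D)) - l * sin (b - D)) =
      (l ^ 2 - m ^ 2) * (m * sin b - l * sin (b - D)) := by
  have h := sin_sq_add_cos_sq D
  rw [sin_sub F, sin_sub, cos_sub]
  unfold quadDen at *
  linear_combination -m * (sin b * cos D - cos b * sin D) * hC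
    + m * (cos b * cos D + sin b * sin D) * hS + m * (l ^ 2 - m ^ 2) * sin b * h

theorem quad_cos_sub (hC : quadDen l m D * cos F = (l ^ 2 + m ^ 2) * cos D - 2 * l * m)
    (hS : quadDen l m D * sin F = (l ^ 2 - m ^ 2) * sin D) (b : ℝ) :
    quadDen l m D * (m * (cos b - cos (F - (b - D)))) =
      2 * l * m * sin D * (m * sin b - l * sin (b - D)) := by
  have h := sin_sq_add_cos_sq D
  rw [cos_sub F, sin_sub, cos_sub]
  unfold quadDen at *
  linear_combination -m * (cos b * cos D + sin b * sin D) * hC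
    - m * (sin b * cos D - cos b * sin D) * hS - m * (l ^ 2 + m ^ 2) * cos b * h

end Trig

/-! ### Partial derivatives -/

theorem hasDerivAt_fst {f : ℝ → ℝ → ℝ} (hf : ContDiff ℝ 2 (Function.uncurry f)) (ξ η : ℝ) :
    HasDerivAt (fun t => f t η) (deriv (fun t => f t η) ξ) ξ := by
  have : ContDiff ℝ 2 (fun t => f t η) := hf.comp (contDiff_id.prodMk contDiff_const)
  exact (this.differentiable (by norm_num) ξ).hasDerivAt

theorem hasDerivAt_snd {f : ℝ → ℝ → ℝ} (hf : ContDiff ℝ 2 (Function.uncurry f)) (ξ η : ℝ) :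
    HasDerivAt (fun t => f ξ t) (deriv (fun t => f ξ t) η) η := by
  have : ContDiff ℝ 2 (fun t => f ξ t) := hf.comp (contDiff_const.prodMk contDiff_id)
  exact (this.differentiable (by norm_num) η).hasDerivAt

/-- A Bianchi quadrilateral: `ω₁`, `ω₂` are Bäcklund transforms of `ω` with parameters `l`, `m`,
and `ω₁₂` is their superposition. -/
structure BianchiQuad (l m : ℝ) (ω ω₁ ω₂ ω₁₂ : ℝ → ℝ → ℝ) : Prop where
  l_ne : l ≠ 0
  m_ne : m ≠ 0
  sq_ne : l ^ 2 ≠ m ^ 2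
  smooth : ContDiff ℝ 2 (Function.uncurry ω)
  smooth₁ : ContDiff ℝ 2 (Function.uncurry ω₁)
  smooth₂ : ContDiff ℝ 2 (Function.uncurry ω₂)
  backlund₁ : IsBacklundTransform l ω ω₁
  backlund₂ : IsBacklundTransform m ω ω₂
  sup : ∀ ξ η, ω₁₂ ξ η = ω ξ η + 2 * supAngle ((l + m) / (l - m)) ((ω₁ ξ η - ω₂ ξ η) / 2)

namespace BianchiQuad

variable {l m : ℝ} {ω ω₁ ω₂ ω₁₂ : ℝ → ℝ → ℝ}

theorem den_pos (h : BianchiQuad l m ω ω₁ ω₂ ω₁₂) (ξ η : ℝ) :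
    0 < quadDen l m (ω₁ ξ η - ω₂ ξ η) := quadDen_pos h.sq_ne _

theorem mul_cos (h : BianchiQuad l m ω ω₁ ω₂ ω₁₂) (ξ η : ℝ) :
    quadDen l m (ω₁ ξ η - ω₂ ξ η) * cos (ω₁₂ ξ η - ω ξ η) =
      (l ^ 2 + m ^ 2) * cos (ω₁ ξ η - ω₂ ξ η) - 2 * l * m := by
  rw [h.sup, add_sub_cancel_left, quadDen_mul_cos h.sq_ne]

theorem mul_sin (h : BianchiQuad l m ω ω₁ ω₂ ω₁₂) (ξ η : ℝ) :
    quadDen l m (ω₁ ξ η - ω₂ ξ η) * sin (ω₁₂ ξ η - ω ξ η) =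
      (l ^ 2 - m ^ 2) * sin (ω₁ ξ η - ω₂ ξ η) := by
  rw [h.sup, add_sub_cancel_left, quadDen_mul_sin h.sq_ne]

theorem smooth₁₂ (h : BianchiQuad l m ω ω₁ ω₂ ω₁₂) : ContDiff ℝ 2 (Function.uncurry ω₁₂) := by
  have hk := div_ne_zero (sq_ne_sq_add h.sq_ne) (sq_ne_sq_sub h.sq_ne)
  have : Function.uncurry ω₁₂ = fun p => Function.uncurry ω p +
      2 * supAngle ((l + m) / (l - m))
        ((Function.uncurry ω₁ p - Function.uncurry ω₂ p) / 2) :=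
    funext fun p => h.sup p.1 p.2
  rw [this]
  exact h.smooth.add (contDiff_const.mul
    ((contDiff_supAngle hk).comp ((h.smooth₁.sub h.smooth₂).div_const 2)))

theorem diff_xi (h : BianchiQuad l m ω ω₁ ω₂ ω₁₂) (ξ η : ℝ) :
    HasDerivAt (fun t => ω₁ t η - ω₂ t η)
      (l * sin (ω₁ ξ η + ω ξ η) - m * sin (ω₂ ξ η + ω ξ η)) ξ := by
  refine ((hasDerivAt_fst h.smooth₁ ξ η).sub (hasDerivAt_fst h.smooth₂ ξ η)).congr_deriv ?_
  rw [h.backlund₁.1, h.backlund₂.1]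
  ring

theorem diff_eta (h : BianchiQuad l m ω ω₁ ω₂ ω₁₂) (ξ η : ℝ) :
    HasDerivAt (fun t => ω₁ ξ t - ω₂ ξ t)
      (1 / l * sin (ω₁ ξ η - ω ξ η) - 1 / m * sin (ω₂ ξ η - ω ξ η)) η := by
  refine ((hasDerivAt_snd h.smooth₁ ξ η).sub (hasDerivAt_snd h.smooth₂ ξ η)).congr_deriv ?_
  rw [h.backlund₁.2, h.backlund₂.2]
  ring

theorem deriv_xi (h : BianchiQuad l m ω ω₁ ω₂ ω₁₂) (ξ η : ℝ) :
    deriv (fun t => ω₁₂ t η) ξ = deriv (fun t => ω t η) ξ +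
      (l ^ 2 - m ^ 2) * (l * sin (ω₁ ξ η + ω ξ η) - m * sin (ω₂ ξ η + ω ξ η)) /
        quadDen l m (ω₁ ξ η - ω₂ ξ η) := by
  have : (fun t => ω₁₂ t η) = fun t => ω t η +
      2 * supAngle ((l + m) / (l - m)) ((ω₁ t η - ω₂ t η) / 2) := funext fun t => h.sup t η
  rw [this]
  exact ((hasDerivAt_fst h.smooth ξ η).add
    (hasDerivAt_two_mul_supAngle h.sq_ne (h.diff_xi ξ η))).deriv

theorem deriv_eta (h : BianchiQuad l m ω ω₁ ω₂ ω₁₂) (ξ η : ℝ) :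
    deriv (fun t => ω₁₂ ξ t) η = deriv (fun t => ω ξ t) η +
      (l ^ 2 - m ^ 2) * (1 / l * sin (ω₁ ξ η - ω ξ η) - 1 / m * sin (ω₂ ξ η - ω ξ η)) /
        quadDen l m (ω₁ ξ η - ω₂ ξ η) := by
  have : (fun t => ω₁₂ ξ t) = fun t => ω ξ t +
      2 * supAngle ((l + m) / (l - m)) ((ω₁ ξ t - ω₂ ξ t) / 2) := funext fun t => h.sup ξ t
  rw [this]
  exact ((hasDerivAt_snd h.smooth ξ η).add
    (hasDerivAt_two_mul_supAngle h.sq_ne (h.diff_eta ξ η))).deriv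

/-- One half of Bianchi permutability: the chain rule through the superposition formula gives the
derivatives of `ω₁₂`, and the trigonometric identities of the quadrilateral rewrite them as the
Bäcklund system over `ω₁`. `backlund_left` is the other half. -/
theorem backlund_right (h : BianchiQuad l m ω ω₁ ω₂ ω₁₂) : IsBacklundTransform m ω₁ ω₁₂ := by
  have hl := h.l_ne
  have hm := h.m_ne
  refine ⟨fun ξ η => ?_, fun ξ η => ?_⟩
  · have hp := (h.den_pos ξ η).ne'
    have e := quad_sin_add_left (h.mul_cos ξ η) (h.mul_sin ξ η) (ω₁ ξ η + ω ξ η)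
    rw [show ω₁ ξ η + ω ξ η + (ω₁₂ ξ η - ω ξ η) = ω₁₂ ξ η + ω₁ ξ η by ring,
      show ω₁ ξ η + ω ξ η - (ω₁ ξ η - ω₂ ξ η) = ω₂ ξ η + ω ξ η by ring] at e
    rw [h.deriv_xi, h.backlund₁.1, ← e, mul_div_cancel_left₀ _ hp]
    ring
  · have hp := (h.den_pos ξ η).ne'
    have e := quad_sin_sub_left (h.mul_cos ξ η) (h.mul_sin ξ η) (ω₁ ξ η - ω ξ η)
    rw [show ω₁₂ ξ η - ω ξ η - (ω₁ ξ η - ω ξ η) = ω₁₂ ξ η - ω₁ ξ η by ring,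
      show ω₁ ξ η - ω ξ η - (ω₁ ξ η - ω₂ ξ η) = ω₂ ξ η - ω ξ η by ring] at e
    rw [h.deriv_eta, h.backlund₁.2]
    field_simp
    linear_combination -e

theorem backlund_left (h : BianchiQuad l m ω ω₁ ω₂ ω₁₂) : IsBacklundTransform l ω₂ ω₁₂ := by
  have hl := h.l_ne
  have hm := h.m_ne
  refine ⟨fun ξ η => ?_, fun ξ η => ?_⟩
  · have hp := (h.den_pos ξ η).ne'
    have e := quad_sin_add_right (h.mul_cos ξ η) (h.mul_sin ξ η) (ω₁ ξ η + ω ξ η)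
    rw [show ω₁ ξ η + ω ξ η - (ω₁ ξ η - ω₂ ξ η) = ω₂ ξ η + ω ξ η by ring,
      show ω₂ ξ η + ω ξ η + (ω₁₂ ξ η - ω ξ η) = ω₁₂ ξ η + ω₂ ξ η by ring] at e
    rw [h.deriv_xi, h.backlund₂.1, ← e, mul_div_cancel_left₀ _ hp]
    ring
  · have hp := (h.den_pos ξ η).ne'
    have e := quad_sin_sub_right (h.mul_cos ξ η) (h.mul_sin ξ η) (ω₁ ξ η - ω ξ η)
    rw [show ω₁ ξ η - ω ξ η - (ω₁ ξ η - ω₂ ξ η) = ω₂ ξ η - ω ξ η by ring,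
      show ω₁₂ ξ η - ω ξ η - (ω₂ ξ η - ω ξ η) = ω₁₂ ξ η - ω₂ ξ η by ring] at e
    rw [h.deriv_eta, h.backlund₂.2]
    field_simp
    linear_combination -e

/-- The derivative of the denominator, in the form needed for the potential `g`. -/
theorem den_xi (h : BianchiQuad l m ω ω₁ ω₂ ω₁₂) (ξ η : ℝ) :
    HasDerivAt (fun t => quadDen l m (ω₁ t η - ω₂ t η))
      (quadDen l m (ω₁ ξ η - ω₂ ξ η) *
        (l * (cos (ω₁ ξ η + ω ξ η) - cos (ω₁₂ ξ η + ω₂ ξ η)))) ξ := by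
  refine (hasDerivAt_quadDen (h.diff_xi ξ η)).congr_deriv ?_
  have e := quad_cos_add (h.mul_cos ξ η) (h.mul_sin ξ η) (ω₁ ξ η + ω ξ η)
  rw [show ω₁ ξ η + ω ξ η - (ω₁ ξ η - ω₂ ξ η) = ω₂ ξ η + ω ξ η by ring,
    show ω₂ ξ η + ω ξ η + (ω₁₂ ξ η - ω ξ η) = ω₁₂ ξ η + ω₂ ξ η by ring] at e
  exact e.symm

theorem den_eta (h : BianchiQuad l m ω ω₁ ω₂ ω₁₂) (ξ η : ℝ) :
    HasDerivAt (fun t => quadDen l m (ω₁ ξ t - ω₂ ξ t))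
      (quadDen l m (ω₁ ξ η - ω₂ ξ η) *
        (1 / l * (cos (ω₁ ξ η - ω ξ η) - cos (ω₁₂ ξ η - ω₂ ξ η)))) η := by
  refine (hasDerivAt_quadDen (h.diff_eta ξ η)).congr_deriv ?_
  have hl := h.l_ne
  have hm := h.m_ne
  have e := quad_cos_sub (h.mul_cos ξ η) (h.mul_sin ξ η) (ω₁ ξ η - ω ξ η)
  rw [show ω₁ ξ η - ω ξ η - (ω₁ ξ η - ω₂ ξ η) = ω₂ ξ η - ω ξ η by ring,
    show ω₁₂ ξ η - ω ξ η - (ω₂ ξ η - ω ξ η) = ω₁₂ ξ η - ω₂ ξ η by ring] at e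
  field_simp
  refine mul_left_cancel₀ hm ?_
  linear_combination -e

end BianchiQuad

/-! ### The Bianchi lattice over the zero seed -/

/-- The first `n` parameters are nonzero and have distinct squares. -/
structure GenericParams (n : ℕ) (lam : ℕ → ℝ) : Prop where
  ne_zero : ∀ i, 1 ≤ i → i ≤ n → lam i ≠ 0
  sq_ne : ∀ i j, 1 ≤ i → i < j → j ≤ n → lam i ^ 2 ≠ lam j ^ 2

theorem contDiff_expo (lam c : ℕ → ℝ) (i : ℕ) :
    ContDiff ℝ 2 (Function.uncurry (expo lam c i)) := by
  unfold expo Function.uncurry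
  exact contDiff_exp.comp (((contDiff_const.mul contDiff_fst).add
    (contDiff_snd.div_const _)).add contDiff_const)

theorem expo_pos (lam c : ℕ → ℝ) (i : ℕ) (ξ η : ℝ) : 0 < expo lam c i ξ η := exp_pos _

theorem expo_xi (lam c : ℕ → ℝ) (i : ℕ) (ξ η : ℝ) :
    HasDerivAt (fun t => expo lam c i t η) (lam i * expo lam c i ξ η) ξ := by
  unfold expo
  refine ((((hasDerivAt_id ξ).const_mul (lam i)).add_const (η / lam i)).add_const
    (c i)).exp.congr_deriv ?_
  simp [mul_comm]

theorem expo_eta (lam c : ℕ → ℝ) (i : ℕ) (ξ η : ℝ) :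
    HasDerivAt (fun t => expo lam c i ξ t) (1 / lam i * expo lam c i ξ η) η := by
  unfold expo
  refine ((((hasDerivAt_id η).div_const (lam i)).const_add (lam i * ξ)).add_const
    (c i)).exp.congr_deriv ?_
  simp [mul_comm]

theorem omega_zero (lam c : ℕ → ℝ) (s : ℕ) : omega lam c s 0 = fun _ _ => 0 := by
  rw [omega]

theorem omega_one (lam c : ℕ → ℝ) (s : ℕ) :
    omega lam c s 1 = fun ξ η => 2 * arctan (expo lam c s ξ η) := by
  rw [omega]

theorem sin_omega_one (lam c : ℕ → ℝ) (s : ℕ) (ξ η : ℝ) :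
    sin (omega lam c s 1 ξ η) = 2 * expo lam c s ξ η / (1 + expo lam c s ξ η ^ 2) := by
  have hp : 0 < 1 + expo lam c s ξ η ^ 2 := by positivity
  have hs : √(1 + expo lam c s ξ η ^ 2) ≠ 0 := (sqrt_pos.mpr hp).ne'
  rw [omega_one, sin_two_mul, sin_arctan, cos_arctan]
  field_simp
  rw [sq_sqrt hp.le]

theorem cos_omega_one (lam c : ℕ → ℝ) (s : ℕ) (ξ η : ℝ) :
    cos (omega lam c s 1 ξ η) =
      (1 - expo lam c s ξ η ^ 2) / (1 + expo lam c s ξ η ^ 2) := by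
  have hp : 0 < 1 + expo lam c s ξ η ^ 2 := by positivity
  rw [omega_one, cos_two_mul, cos_sq_arctan]
  field_simp
  ring

theorem contDiff_omega_one (lam c : ℕ → ℝ) (s : ℕ) :
    ContDiff ℝ 2 (Function.uncurry (omega lam c s 1)) := by
  rw [omega_one]
  exact contDiff_const.mul (contDiff_arctan.comp (contDiff_expo lam c s))

theorem backlund_omega_one (lam c : ℕ → ℝ) (s : ℕ) :
    IsBacklundTransform (lam s) (fun _ _ => 0) (omega lam c s 1) := by
  refine ⟨fun ξ η => ?_, fun ξ η => ?_⟩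
  · rw [add_zero, sin_omega_one, omega_one, deriv_const, zero_add]
    refine ((expo_xi lam c s ξ η).arctan.const_mul 2).deriv.trans ?_
    ring
  · rw [sub_zero, sin_omega_one, omega_one, deriv_const, neg_zero, zero_add]
    refine ((expo_eta lam c s ξ η).arctan.const_mul 2).deriv.trans ?_
    ring

variable {n : ℕ} {lam : ℕ → ℝ}

/-- A new quadrilateral needs an edge that drops the first index and an edge that drops the last
one, starting from the same inner interval. Both kinds are therefore carried through the induction,
which uses the hypothesis at `s` and at `s + 1`. -/
theorem omega_smooth_and_backlund (hg : GenericParams n lam) (c : ℕ → ℝ) (j : ℕ) :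
    ∀ s, 1 ≤ s → s + (j + 1) ≤ n + 1 →
      ContDiff ℝ 2 (Function.uncurry (omega lam c s j)) ∧
      ContDiff ℝ 2 (Function.uncurry (omega lam c (s + 1) j)) ∧
      ContDiff ℝ 2 (Function.uncurry (omega lam c s (j + 1))) ∧
      IsBacklundTransform (lam s) (omega lam c (s + 1) j) (omega lam c s (j + 1)) ∧
      IsBacklundTransform (lam (s + j)) (omega lam c s j) (omega lam c s (j + 1)) := by
  induction j with
  | zero =>
    intro s hs hj
    rw [omega_zero, omega_zero]
    exact ⟨contDiff_const, contDiff_const, contDiff_omega_one lam c s,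
      backlund_omega_one lam c s, backlund_omega_one lam c s⟩
  | succ j ih =>
    intro s hs hj
    obtain ⟨_, h2, h3, h4, _⟩ := ih s hs (by omega)
    obtain ⟨_, _, h3', _, h5'⟩ := ih (s + 1) (by omega) (by omega)
    rw [show s + 1 + j = s + j + 1 by ring] at h5'
    have q : BianchiQuad (lam s) (lam (s + j + 1)) (omega lam c (s + 1) j)
        (omega lam c s (j + 1)) (omega lam c (s + 1) (j + 1)) (omega lam c s (j + 2)) :=
      ⟨hg.ne_zero _ hs (by omega), hg.ne_zero _ (by omega) (by omega),
        hg.sq_ne _ _ hs (by omega) (by omega), h2, h3, h3', h4, h5', fun ξ η => by rw [omega]⟩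
    exact ⟨h3, h3', q.smooth₁₂, q.backlund_left, q.backlund_right⟩

theorem bianchiQuad_omega (hg : GenericParams n lam) (c : ℕ → ℝ) {s j : ℕ} (hs : 1 ≤ s)
    (hj : s + (j + 2) ≤ n + 1) :
    BianchiQuad (lam s) (lam (s + j + 1)) (omega lam c (s + 1) j)
      (omega lam c s (j + 1)) (omega lam c (s + 1) (j + 1)) (omega lam c s (j + 2)) := by
  obtain ⟨_, h2, h3, h4, _⟩ := omega_smooth_and_backlund hg c j s hs (by omega)
  obtain ⟨_, _, h3', _, h5'⟩ := omega_smooth_and_backlund hg c j (s + 1) (by omega) (by omega)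
  rw [show s + 1 + j = s + j + 1 by ring] at h5'
  exact ⟨hg.ne_zero _ hs (by omega), hg.ne_zero _ (by omega) (by omega),
    hg.sq_ne _ _ hs (by omega) (by omega), h2, h3, h3', h4, h5', fun ξ η => by rw [omega]⟩

theorem contDiff_omega (hg : GenericParams n lam) (c : ℕ → ℝ) {s j : ℕ} (hs : 1 ≤ s)
    (hj : s + j ≤ n + 1) : ContDiff ℝ 2 (Function.uncurry (omega lam c s j)) := by
  cases j with
  | zero => rw [omega_zero]; exact contDiff_const
  | succ j => exact (omega_smooth_and_backlund hg c j s hs hj).2.2.1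

theorem backlund_omega (hg : GenericParams n lam) (c : ℕ → ℝ) {s j : ℕ} (hs : 1 ≤ s)
    (hj : s + (j + 1) ≤ n + 1) :
    IsBacklundTransform (lam s) (omega lam c (s + 1) j) (omega lam c s (j + 1)) :=
  (omega_smooth_and_backlund hg c j s hs hj).2.2.2.1

/-- A Bäcklund transform of a sine-Gordon solution is a sine-Gordon solution. -/
theorem IsBacklundTransform.isSineGordonSolution {l : ℝ} (hl : l ≠ 0) {ω ω' : ℝ → ℝ → ℝ}
    (h : IsBacklundTransform l ω ω')
    (hω : ContDiff ℝ 2 (Function.uncurry ω)) (hω' : ContDiff ℝ 2 (Function.uncurry ω'))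
    (hsg : ∀ ξ η, HasDerivAt (fun η' => deriv (fun ξ' => ω ξ' η') ξ)
      (1 / 2 * sin (2 * ω ξ η)) η) (ξ η : ℝ) :
    HasDerivAt (fun η' => deriv (fun ξ' => ω' ξ' η') ξ) (1 / 2 * sin (2 * ω' ξ η)) η := by
  have e : (fun η' => deriv (fun ξ' => ω' ξ' η') ξ) =
      fun η' => deriv (fun ξ' => ω ξ' η') ξ + l * sin (ω' ξ η' + ω ξ η') :=
    funext fun η' => h.1 ξ η'
  rw [e]
  refine ((hsg ξ η).add (((hasDerivAt_snd hω' ξ η).add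
    (hasDerivAt_snd hω ξ η)).sin.const_mul l)).congr_deriv ?_
  -- The second Bäcklund equation turns `ω'_η + ω_η` into `sin (ω' - ω) / l`; what remains is `cos
  -- (ω' + ω) sin (ω' - ω) = (sin 2ω' - sin 2ω) / 2`.
  rw [h.2]
  simp only [Pi.add_apply]
  have h1 := sin_sq_add_cos_sq (ω ξ η)
  have h2 := sin_sq_add_cos_sq (ω' ξ η)
  rw [sin_two_mul, sin_two_mul, sin_sub, cos_add]
  field_simp
  linear_combination sin (ω' ξ η) * cos (ω' ξ η) * h1 - sin (ω ξ η) * cos (ω ξ η) * h2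

theorem hasDerivAt_deriv_omega (hg : GenericParams n lam) (c : ℕ → ℝ) (j : ℕ) :
    ∀ s, 1 ≤ s → s + j ≤ n + 1 → ∀ ξ η,
      HasDerivAt (fun η' => deriv (fun ξ' => omega lam c s j ξ' η') ξ)
        (1 / 2 * sin (2 * omega lam c s j ξ η)) η := by
  induction j with
  | zero =>
    intro s _ _ ξ η
    rw [omega_zero]
    simpa using hasDerivAt_const η (0 : ℝ)
  | succ j ih =>
    intro s hs hj
    exact (backlund_omega hg c hs hj).isSineGordonSolution (hg.ne_zero s hs (by omega))
      (contDiff_omega hg c (by omega) (by omega)) (contDiff_omega hg c hs hj)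
      (ih (s + 1) (by omega) (by omega))

theorem isSineGordonSolution_omega (hg : GenericParams n lam) (c : ℕ → ℝ) {s j : ℕ} (hs : 1 ≤ s)
    (hj : s + j ≤ n + 1) : IsSineGordonSolution (omega lam c s j) :=
  ⟨contDiff_omega hg c hs hj, fun ξ η => (hasDerivAt_deriv_omega hg c j s hs hj ξ η).deriv⟩

end CAE

namespace CAE

open Real

/-! ### Transport of the associated potentials along a quadrilateral -/

section Trig

variable {l m D F : ℝ}

/-- What the `ξ`-derivative of `2 sin (ω₂ - ω₁) / h * g` comes down to, with `h = quadDen l m D`.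
Multiplying by `l h` makes it possible to eliminate the sine and cosine of `ω₁₂ + ω₂`. -/
theorem quad_x_xi (h : l ^ 2 ≠ m ^ 2) (hl : l ≠ 0)
    (hC : quadDen l m D * cos F = (l ^ 2 + m ^ 2) * cos D - 2 * l * m)
    (hS : quadDen l m D * sin F = (l ^ 2 - m ^ 2) * sin D) (a : ℝ) :
    quadDen l m D * sin a + 2 * m * cos D * (l * sin a - m * sin (a - D))
      + 2 * l * m * sin D * cos (a - D + F) = (l ^ 2 - m ^ 2) * sin (a - D + F) := by
  have hp := (quadDen_pos h D).ne'
  have e1 := quad_sin_add_right hC hS a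
  have e2 := quad_cos_add hC hS a
  have h1 := sin_sq_add_cos_sq D
  refine mul_left_cancel₀ hl (mul_left_cancel₀ hp ?_)
  generalize sin (a - D + F) = u at *
  generalize cos (a - D + F) = v at *
  rw [sin_sub] at *
  unfold quadDen at *
  linear_combination -(l ^ 2 - m ^ 2) * e1 - 2 * l * m * sin D * e2
    - 4 * l ^ 2 * m ^ 2 * (l * sin a - m * (sin a * cos D - cos a * sin D)) * h1

theorem quad_y_xi (hl : l ≠ 0)
    (hC : quadDen l m D * cos F = (l ^ 2 + m ^ 2) * cos D - 2 * l * m)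
    (hS : quadDen l m D * sin F = (l ^ 2 - m ^ 2) * sin D) (a : ℝ) :
    (l ^ 2 - m ^ 2) * sin a + 2 * m * (l * sin D * cos a
      - cos D * (l * sin a - m * sin (a - D))) = quadDen l m D * sin (a - D + F) := by
  have e1 := quad_sin_add_right hC hS a
  refine mul_left_cancel₀ hl ?_
  generalize sin (a - D + F) = u at *
  rw [sin_sub] at *
  unfold quadDen at *
  linear_combination -e1

theorem quad_x_eta (h : l ^ 2 ≠ m ^ 2) (hm : m ≠ 0)
    (hC : quadDen l m D * cos F = (l ^ 2 + m ^ 2) * cos D - 2 * l * m)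
    (hS : quadDen l m D * sin F = (l ^ 2 - m ^ 2) * sin D) (b : ℝ) :
    quadDen l m D * sin b + 2 * l * cos D * (m * sin b - l * sin (b - D))
      + 2 * l * m * sin D * cos (F - (b - D)) = (l ^ 2 - m ^ 2) * sin (F - (b - D)) := by
  have hp := (quadDen_pos h D).ne'
  have e1 := quad_sin_sub_right hC hS b
  have e2 := quad_cos_sub hC hS b
  have h1 := sin_sq_add_cos_sq D
  refine mul_left_cancel₀ hm (mul_left_cancel₀ hp ?_)
  generalize sin (F - (b - D)) = u at *
  generalize cos (F - (b - D)) = v at *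
  rw [sin_sub] at *
  unfold quadDen at *
  linear_combination -(l ^ 2 - m ^ 2) * e1 - 2 * l * m * sin D * e2
    - 4 * l ^ 2 * m ^ 2 * (m * sin b - l * (sin b * cos D - cos b * sin D)) * h1

theorem quad_y_eta (hm : m ≠ 0)
    (hC : quadDen l m D * cos F = (l ^ 2 + m ^ 2) * cos D - 2 * l * m)
    (hS : quadDen l m D * sin F = (l ^ 2 - m ^ 2) * sin D) (b : ℝ) :
    (l ^ 2 - m ^ 2) * sin b + 2 * l * (cos D * (m * sin b - l * sin (b - D))
      - m * sin D * cos b) = quadDen l m D * sin (F - (b - D)) := by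
  have e1 := quad_sin_sub_right hC hS b
  refine mul_left_cancel₀ hm ?_
  generalize sin (F - (b - D)) = u at *
  rw [sin_sub] at *
  unfold quadDen at *
  linear_combination -e1

end Trig

namespace BianchiQuad

variable {l m : ℝ} {ω ω₁ ω₂ ω₁₂ g : ℝ → ℝ → ℝ}

/-- The derivative of the correction to `x` splits into a multiple of the old `x_ξ` and a multiple
of the new one. In `PotentialStep.x_eq` the coefficients are such that the old part cancels. The
three companion lemmas play the same role for `x_η`, `y_ξ` and `y_η`. -/
theorem x_term_xi (q : BianchiQuad l m ω ω₁ ω₂ ω₁₂) {ξ η : ℝ}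
    (hg : HasDerivAt (fun t => g t η) (g ξ η * l * cos (ω₁ ξ η + ω ξ η)) ξ) :
    HasDerivAt (fun t => 2 * sin (ω₂ t η - ω₁ t η) / quadDen l m (ω₁ t η - ω₂ t η) * g t η)
      (g ξ η / m * (sin (ω₁ ξ η + ω ξ η) + (m ^ 2 - l ^ 2) /
        quadDen l m (ω₁ ξ η - ω₂ ξ η) * sin (ω₁₂ ξ η + ω₂ ξ η))) ξ := by
  have hm := q.m_ne
  have hp := (q.den_pos ξ η).ne'
  have e := quad_x_xi q.sq_ne q.l_ne (q.mul_cos ξ η) (q.mul_sin ξ η) (ω₁ ξ η + ω ξ η)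
  rw [show ω₁ ξ η + ω ξ η - (ω₁ ξ η - ω₂ ξ η) = ω₂ ξ η + ω ξ η by ring,
    show ω₂ ξ η + ω ξ η + (ω₁₂ ξ η - ω ξ η) = ω₁₂ ξ η + ω₂ ξ η by ring] at e
  have hf : (fun t => 2 * sin (ω₂ t η - ω₁ t η) / quadDen l m (ω₁ t η - ω₂ t η) * g t η) =
      fun t => -2 * sin (ω₁ t η - ω₂ t η) / quadDen l m (ω₁ t η - ω₂ t η) * g t η := by
    funext t
    rw [← neg_sub (ω₁ t η), sin_neg]
    ring
  rw [hf]
  refine (((((q.diff_xi ξ η).sin.const_mul (-2)).fun_div (q.den_xi ξ η) hp).fun_mul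
    hg)).congr_deriv ?_
  generalize quadDen l m (ω₁ ξ η - ω₂ ξ η) = h at *
  field_simp
  linear_combination -g ξ η * e

theorem x_term_eta (q : BianchiQuad l m ω ω₁ ω₂ ω₁₂) {ξ η : ℝ}
    (hg : HasDerivAt (fun t => g ξ t) (g ξ η * (1 / l) * cos (ω₁ ξ η - ω ξ η)) η) :
    HasDerivAt (fun t => 2 * sin (ω₂ ξ t - ω₁ ξ t) / quadDen l m (ω₁ ξ t - ω₂ ξ t) * g ξ t)
      (g ξ η / (m * l ^ 2) * (sin (ω₁ ξ η - ω ξ η) + (m ^ 2 - l ^ 2) /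
        quadDen l m (ω₁ ξ η - ω₂ ξ η) * sin (ω₁₂ ξ η - ω₂ ξ η))) η := by
  have hl := q.l_ne
  have hm := q.m_ne
  have hp := (q.den_pos ξ η).ne'
  have e := quad_x_eta q.sq_ne q.m_ne (q.mul_cos ξ η) (q.mul_sin ξ η) (ω₁ ξ η - ω ξ η)
  rw [show ω₁ ξ η - ω ξ η - (ω₁ ξ η - ω₂ ξ η) = ω₂ ξ η - ω ξ η by ring,
    show ω₁₂ ξ η - ω ξ η - (ω₂ ξ η - ω ξ η) = ω₁₂ ξ η - ω₂ ξ η by ring] at e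
  have hf : (fun t => 2 * sin (ω₂ ξ t - ω₁ ξ t) / quadDen l m (ω₁ ξ t - ω₂ ξ t) * g ξ t) =
      fun t => -2 * sin (ω₁ ξ t - ω₂ ξ t) / quadDen l m (ω₁ ξ t - ω₂ ξ t) * g ξ t := by
    funext t
    rw [← neg_sub (ω₁ ξ t), sin_neg]
    ring
  rw [hf]
  refine (((((q.diff_eta ξ η).sin.const_mul (-2)).fun_div (q.den_eta ξ η) hp).fun_mul
    hg)).congr_deriv ?_
  generalize quadDen l m (ω₁ ξ η - ω₂ ξ η) = h at *
  field_simp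
  linear_combination -g ξ η * e

theorem y_term_xi (q : BianchiQuad l m ω ω₁ ω₂ ω₁₂) {ξ η : ℝ} (h0 : g ξ η ≠ 0)
    (hg : HasDerivAt (fun t => g t η) (g ξ η * l * cos (ω₁ ξ η + ω ξ η)) ξ) :
    HasDerivAt (fun t => 2 * sin (ω₂ t η - ω₁ t η) / g t η)
      (((m ^ 2 - l ^ 2) * sin (ω₁ ξ η + ω ξ η) +
        quadDen l m (ω₁ ξ η - ω₂ ξ η) * sin (ω₁₂ ξ η + ω₂ ξ η)) / (m * g ξ η)) ξ := by
  have hm := q.m_ne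
  have e := quad_y_xi q.l_ne (q.mul_cos ξ η) (q.mul_sin ξ η) (ω₁ ξ η + ω ξ η)
  rw [show ω₁ ξ η + ω ξ η - (ω₁ ξ η - ω₂ ξ η) = ω₂ ξ η + ω ξ η by ring,
    show ω₂ ξ η + ω ξ η + (ω₁₂ ξ η - ω ξ η) = ω₁₂ ξ η + ω₂ ξ η by ring] at e
  have hf : (fun t => 2 * sin (ω₂ t η - ω₁ t η) / g t η) =
      fun t => -2 * sin (ω₁ t η - ω₂ t η) / g t η := by
    funext t
    rw [← neg_sub (ω₁ t η), sin_neg]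
    ring
  rw [hf]
  refine (((q.diff_xi ξ η).sin.const_mul (-2)).fun_div hg h0).congr_deriv ?_
  field_simp
  linear_combination e

theorem y_term_eta (q : BianchiQuad l m ω ω₁ ω₂ ω₁₂) {ξ η : ℝ} (h0 : g ξ η ≠ 0)
    (hg : HasDerivAt (fun t => g ξ t) (g ξ η * (1 / l) * cos (ω₁ ξ η - ω ξ η)) η) :
    HasDerivAt (fun t => 2 * sin (ω₂ ξ t - ω₁ ξ t) / g ξ t)
      (-(((m ^ 2 - l ^ 2) * sin (ω₁ ξ η - ω ξ η) +
        quadDen l m (ω₁ ξ η - ω₂ ξ η) * sin (ω₁₂ ξ η - ω₂ ξ η)) / (l ^ 2 * m * g ξ η))) η := by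
  have hl := q.l_ne
  have hm := q.m_ne
  have e := quad_y_eta q.m_ne (q.mul_cos ξ η) (q.mul_sin ξ η) (ω₁ ξ η - ω ξ η)
  rw [show ω₁ ξ η - ω ξ η - (ω₁ ξ η - ω₂ ξ η) = ω₂ ξ η - ω ξ η by ring,
    show ω₁₂ ξ η - ω ξ η - (ω₂ ξ η - ω ξ η) = ω₁₂ ξ η - ω₂ ξ η by ring] at e
  have hf : (fun t => 2 * sin (ω₂ ξ t - ω₁ ξ t) / g ξ t) =
      fun t => -2 * sin (ω₁ ξ t - ω₂ ξ t) / g ξ t := by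
    funext t
    rw [← neg_sub (ω₁ ξ t), sin_neg]
    ring
  rw [hf]
  refine (((q.diff_eta ξ η).sin.const_mul (-2)).fun_div hg h0).congr_deriv ?_
  field_simp
  linear_combination -e

end BianchiQuad

/-- The transformation of the potentials along a Bianchi quadrilateral, with both directions of
transport in `associated_right` and `associated_left`. -/
structure PotentialStep (l m : ℝ) (ω₁ ω₂ : ℝ → ℝ → ℝ) (x y g x' y' g' : ℝ → ℝ → ℝ) : Prop where
  g_eq : ∀ ξ η, g' ξ η = -(m * l) / quadDen l m (ω₁ ξ η - ω₂ ξ η) * g ξ η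
  x_eq : ∀ ξ η, x' ξ η = m * l / (m ^ 2 - l ^ 2) * x ξ η + m ^ 2 * l ^ 2 / (l ^ 2 - m ^ 2) *
    (2 * sin (ω₂ ξ η - ω₁ ξ η) / quadDen l m (ω₁ ξ η - ω₂ ξ η) * g ξ η)
  y_eq : ∀ ξ η, y' ξ η = (m ^ 2 - l ^ 2) / (m * l) * y ξ η -
    2 * sin (ω₂ ξ η - ω₁ ξ η) / g ξ η

namespace PotentialStep

variable {l m : ℝ} {ω ω₁ ω₂ ω₁₂ x y g x' y' g' : ℝ → ℝ → ℝ}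

/-- For `g'`, the logarithmic derivative of `1/h` replaces the cosine of the edge `ω, ω₁` by that of
`ω₂, ω₁₂`; for `x'` and `y'`, the correction terms exchange the sines in the same way. -/
theorem associated_right (p : PotentialStep l m ω₁ ω₂ x y g x' y' g')
    (q : BianchiQuad l m ω ω₁ ω₂ ω₁₂) (h₂ : IsSineGordonSolution ω₂)
    (h₁₂ : IsSineGordonSolution ω₁₂) (h : IsAssociatedPotentials l ω ω₁ x y g) :
    IsAssociatedPotentials l ω₂ ω₁₂ x' y' g' := by
  have hl := q.l_ne
  have hm := q.m_ne
  have hlm : l ^ 2 - m ^ 2 ≠ 0 := sub_ne_zero.mpr q.sq_ne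
  have hml : m ^ 2 - l ^ 2 ≠ 0 := sub_ne_zero.mpr q.sq_ne.symm
  refine ⟨h₂, h₁₂, q.backlund_left, fun ξ η => ?_, fun ξ η => ?_, fun ξ η => ?_, fun ξ η => ?_,
    fun ξ η => ?_, fun ξ η => ?_, fun ξ η => ?_⟩ <;>
  have hp := (q.den_pos ξ η).ne' <;> have h0 := h.g_ne_zero ξ η <;> have eg := p.g_eq ξ η
  · rw [eg]
    exact mul_ne_zero (div_ne_zero (neg_ne_zero.mpr (mul_ne_zero hm hl)) hp) h0
  · rw [eg, funext fun t => p.g_eq t η]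
    refine (((hasDerivAt_const ξ _).fun_div (q.den_xi ξ η) hp).fun_mul
      (h.g_xi ξ η)).congr_deriv ?_
    field_simp
    ring
  · rw [eg, funext fun t => p.g_eq ξ t]
    refine (((hasDerivAt_const η _).fun_div (q.den_eta ξ η) hp).fun_mul
      (h.g_eta ξ η)).congr_deriv ?_
    field_simp
    ring
  · rw [eg, funext fun t => p.x_eq t η]
    refine (((h.x_xi ξ η).const_mul _).fun_add
      ((q.x_term_xi (h.g_xi ξ η)).const_mul _)).congr_deriv ?_
    generalize quadDen l m (ω₁ ξ η - ω₂ ξ η) = d at *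
    rw [← neg_sub (l ^ 2)]
    field_simp
    ring
  · rw [eg, funext fun t => p.x_eq ξ t]
    refine (((h.x_eta ξ η).const_mul _).fun_add
      ((q.x_term_eta (h.g_eta ξ η)).const_mul _)).congr_deriv ?_
    generalize quadDen l m (ω₁ ξ η - ω₂ ξ η) = d at *
    rw [← neg_sub (l ^ 2)]
    field_simp
    ring
  · rw [eg, funext fun t => p.y_eq t η]
    refine (((h.y_xi ξ η).const_mul _).fun_sub
      (q.y_term_xi h0 (h.g_xi ξ η))).congr_deriv ?_
    generalize quadDen l m (ω₁ ξ η - ω₂ ξ η) = d at *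
    field_simp
    ring
  · rw [eg, funext fun t => p.y_eq ξ t]
    refine (((h.y_eta ξ η).const_mul _).fun_sub
      (q.y_term_eta h0 (h.g_eta ξ η))).congr_deriv ?_
    generalize quadDen l m (ω₁ ξ η - ω₂ ξ η) = d at *
    field_simp
    ring

theorem associated_left (p : PotentialStep l m ω₁ ω₂ x y g x' y' g')
    (q : BianchiQuad l m ω ω₁ ω₂ ω₁₂) (h₀ : IsSineGordonSolution ω)
    (h₁ : IsSineGordonSolution ω₁) (h : IsAssociatedPotentials l ω₂ ω₁₂ x' y' g') :
    IsAssociatedPotentials l ω ω₁ x y g := by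
  have hl := q.l_ne
  have hm := q.m_ne
  have hlm : l ^ 2 - m ^ 2 ≠ 0 := sub_ne_zero.mpr q.sq_ne
  have hml : m ^ 2 - l ^ 2 ≠ 0 := sub_ne_zero.mpr q.sq_ne.symm
  -- Differentiability is known only for the primed triple, so the step is solved for the old one.
  -- `g` has to be treated first, because the correction terms of `x` and `y` contain it.
  have gx : ∀ ξ η, g ξ η = -(quadDen l m (ω₁ ξ η - ω₂ ξ η) * g' ξ η) / (m * l) := by
    intro ξ η
    have hp := (q.den_pos ξ η).ne'
    rw [p.g_eq]
    field_simp
  have g_ne : ∀ ξ η, g ξ η ≠ 0 := by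
    intro ξ η h0
    apply h.g_ne_zero ξ η
    rw [p.g_eq, h0, mul_zero]
  have g_xi : ∀ ξ η,
      HasDerivAt (fun t => g t η) (g ξ η * l * cos (ω₁ ξ η + ω ξ η)) ξ := by
    intro ξ η
    rw [gx ξ η, funext fun t => gx t η]
    refine ((((q.den_xi ξ η).fun_mul (h.g_xi ξ η)).fun_neg).div_const _).congr_deriv ?_
    field_simp
    ring
  have g_eta : ∀ ξ η,
      HasDerivAt (fun t => g ξ t) (g ξ η * (1 / l) * cos (ω₁ ξ η - ω ξ η)) η := by
    intro ξ η
    rw [gx ξ η, funext fun t => gx ξ t]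
    refine ((((q.den_eta ξ η).fun_mul (h.g_eta ξ η)).fun_neg).div_const _).congr_deriv ?_
    field_simp
    ring
  have xx : ∀ ξ η, x ξ η = (m ^ 2 - l ^ 2) / (m * l) * x' ξ η + m * l *
      (2 * sin (ω₂ ξ η - ω₁ ξ η) / quadDen l m (ω₁ ξ η - ω₂ ξ η) * g ξ η) := by
    intro ξ η
    rw [p.x_eq, ← neg_sub (m ^ 2) (l ^ 2)]
    generalize 2 * sin (ω₂ ξ η - ω₁ ξ η) / quadDen l m (ω₁ ξ η - ω₂ ξ η) * g ξ η = K
    field_simp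
    ring
  have yy : ∀ ξ η, y ξ η = m * l / (m ^ 2 - l ^ 2) * (y' ξ η +
      2 * sin (ω₂ ξ η - ω₁ ξ η) / g ξ η) := by
    intro ξ η
    rw [p.y_eq]
    field_simp
    ring
  refine ⟨h₀, h₁, q.backlund₁, g_ne, g_xi, g_eta, fun ξ η => ?_,
    fun ξ η => ?_, fun ξ η => ?_, fun ξ η => ?_⟩ <;>
  have hp := (q.den_pos ξ η).ne' <;> have h0 := g_ne ξ η <;> have eg := p.g_eq ξ η
  · rw [funext fun t => xx t η]
    refine (((h.x_xi ξ η).const_mul _).fun_add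
      ((q.x_term_xi (g_xi ξ η)).const_mul _)).congr_deriv ?_
    rw [eg]
    generalize quadDen l m (ω₁ ξ η - ω₂ ξ η) = d at *
    field_simp
    ring
  · rw [funext fun t => xx ξ t]
    refine (((h.x_eta ξ η).const_mul _).fun_add
      ((q.x_term_eta (g_eta ξ η)).const_mul _)).congr_deriv ?_
    rw [eg]
    generalize quadDen l m (ω₁ ξ η - ω₂ ξ η) = d at *
    field_simp
    ring
  · rw [funext fun t => yy t η]
    refine (((h.y_xi ξ η).fun_add (q.y_term_xi h0 (g_xi ξ η))).const_mul _).congr_deriv ?_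
    rw [eg]
    generalize quadDen l m (ω₁ ξ η - ω₂ ξ η) = d at *
    field_simp
    ring
  · rw [funext fun t => yy ξ t]
    refine (((h.y_eta ξ η).fun_add (q.y_term_eta h0 (g_eta ξ η))).const_mul _).congr_deriv ?_
    rw [eg]
    generalize quadDen l m (ω₁ ξ η - ω₂ ξ η) = d at *
    field_simp
    ring

end PotentialStep

end CAE

namespace CAE

open Matrix

/-! ### Solutions of a Lyapunov equation and their dressing matrices -/

section Lyapunov

variable {ι κ : Type*}

/-- The solution `M` of `diag l * M + M * diag l = P * Pᵀ`. -/
def lyap (l : ι → ℝ) (P : Matrix ι (Fin 2) ℝ) : Matrix ι ι ℝ :=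
  of fun p q => (P * Pᵀ) p q / (l p + l q)

theorem lyap_transpose (l : ι → ℝ) (P : Matrix ι (Fin 2) ℝ) : (lyap l P)ᵀ = lyap l P := by
  ext p q
  simp only [lyap, transpose_apply, of_apply, mul_apply]
  rw [add_comm (l q)]
  congr 1
  exact Finset.sum_congr rfl fun _ _ => mul_comm _ _

theorem lyap_submatrix (e : κ ≃ ι) (l : ι → ℝ) (P : Matrix ι (Fin 2) ℝ) :
    lyap (l ∘ e) (P.submatrix e id) = (lyap l P).submatrix e e := rfl

/-- The resolvent `(diag l + z)⁻¹`. -/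
def resolv [DecidableEq ι] (l : ι → ℝ) (z : ℝ) : Matrix ι ι ℝ := diagonal fun i => (l i + z)⁻¹

theorem resolv_transpose [DecidableEq ι] (l : ι → ℝ) (z : ℝ) : (resolv l z)ᵀ = resolv l z :=
  diagonal_transpose _

variable [Fintype ι] [DecidableEq ι] [Fintype κ] [DecidableEq κ]

/-- The dressing matrix `1 - Pᵀ M⁻¹ (diag l + z)⁻¹ P`. -/
def dress (l : ι → ℝ) (P : Matrix ι (Fin 2) ℝ) (z : ℝ) : Matrix (Fin 2) (Fin 2) ℝ :=
  1 - Pᵀ * (lyap l P)⁻¹ * resolv l z * P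

theorem resolv_mul (l : ι → ℝ) {z : ℝ} (hz : ∀ i, l i + z ≠ 0) :
    resolv l z * diagonal (fun i => l i + z) = 1 := by
  rw [resolv, diagonal_mul_diagonal, ← diagonal_one]
  congr 1
  funext i
  exact inv_mul_cancel₀ (hz i)

theorem mul_resolv (l : ι → ℝ) {z : ℝ} (hz : ∀ i, l i + z ≠ 0) :
    diagonal (fun i => l i + z) * resolv l z = 1 := by
  rw [resolv, diagonal_mul_diagonal, ← diagonal_one]
  congr 1
  funext i
  exact mul_inv_cancel₀ (hz i)

theorem mul_transpose_eq_lyap (l : ι → ℝ) (P : Matrix ι (Fin 2) ℝ)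
    (hl : ∀ i j, l i + l j ≠ 0) (u z : ℝ) :
    P * Pᵀ = diagonal (fun i => l i + z) * lyap l P + lyap l P * diagonal (fun i => l i + u)
      - (u + z) • lyap l P := by
  ext p q
  rw [Matrix.sub_apply, Matrix.add_apply, diagonal_mul, mul_diagonal, Matrix.smul_apply, smul_eq_mul,
    lyap, of_apply]
  generalize (P * Pᵀ) p q = t
  have := hl p q
  field_simp
  ring

theorem dress_transpose (l : ι → ℝ) (P : Matrix ι (Fin 2) ℝ) (u : ℝ) :
    (dress l P u)ᵀ = 1 - Pᵀ * resolv l u * (lyap l P)⁻¹ * P := by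
  simp only [dress, transpose_sub, transpose_one, transpose_mul, transpose_transpose,
    resolv_transpose, transpose_nonsing_inv, lyap_transpose, Matrix.mul_assoc]

/-- Writing `R_u = (Λ + u)⁻¹`, the quadratic term of the product contains `R_u M⁻¹ (P Pᵀ) M⁻¹ R_z`;
the Lyapunov equation, shifted by `u` and `z`, reduces it to terms that cancel the linear ones. -/
theorem dress_transpose_mul_dress {l : ι → ℝ} {P : Matrix ι (Fin 2) ℝ}
    (hl : ∀ i j, l i + l j ≠ 0) (hM : (lyap l P).det ≠ 0) {u z : ℝ}
    (hu : ∀ i, l i + u ≠ 0) (hz : ∀ i, l i + z ≠ 0) :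
    (dress l P u)ᵀ * dress l P z =
      1 - (u + z) • (Pᵀ * resolv l u * (lyap l P)⁻¹ * resolv l z * P) := by
  have hU : IsUnit (lyap l P).det := isUnit_iff_ne_zero.mpr hM
  have hmid : resolv l u * ((lyap l P)⁻¹ * (P * Pᵀ) * (lyap l P)⁻¹) * resolv l z =
      resolv l u * (lyap l P)⁻¹ + (lyap l P)⁻¹ * resolv l z
        - (u + z) • (resolv l u * (lyap l P)⁻¹ * resolv l z) := by
    rw [mul_transpose_eq_lyap l P hl u z]
    simp only [Matrix.mul_add, Matrix.mul_sub, Matrix.add_mul, Matrix.sub_mul, Matrix.mul_smul,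
      Matrix.smul_mul]
    have e1 : resolv l u * ((lyap l P)⁻¹ * (diagonal (fun i => l i + z) * lyap l P) *
        (lyap l P)⁻¹) * resolv l z = resolv l u * (lyap l P)⁻¹ := by
      rw [Matrix.mul_assoc (lyap l P)⁻¹, Matrix.mul_assoc (diagonal _), mul_nonsing_inv _ hU,
        Matrix.mul_one, Matrix.mul_assoc, Matrix.mul_assoc _ (diagonal _), mul_resolv l hz,
        Matrix.mul_one]
    have e2 : resolv l u * ((lyap l P)⁻¹ * (lyap l P * diagonal (fun i => l i + u)) *
        (lyap l P)⁻¹) * resolv l z = (lyap l P)⁻¹ * resolv l z := by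
      rw [← Matrix.mul_assoc (lyap l P)⁻¹, nonsing_inv_mul _ hU, Matrix.one_mul,
        ← Matrix.mul_assoc, resolv_mul l hu, Matrix.one_mul]
    rw [e1, e2, nonsing_inv_mul _ hU, Matrix.one_mul]
  rw [dress_transpose, dress, Matrix.sub_mul, Matrix.mul_sub, Matrix.mul_sub, Matrix.one_mul,
    Matrix.mul_one, Matrix.one_mul]
  have : Pᵀ * resolv l u * (lyap l P)⁻¹ * P * (Pᵀ * (lyap l P)⁻¹ * resolv l z * P) =
      Pᵀ * (resolv l u * ((lyap l P)⁻¹ * (P * Pᵀ) * (lyap l P)⁻¹) * resolv l z) * P := by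
    simp only [Matrix.mul_assoc]
  rw [this, hmid]
  simp only [Matrix.mul_add, Matrix.mul_sub, Matrix.add_mul, Matrix.sub_mul, Matrix.mul_smul,
    Matrix.smul_mul, Matrix.mul_assoc]
  abel

/-- Independence of the order of the indices: this is why an interval may be extended at either end.
-/
theorem dress_submatrix (e : κ ≃ ι) (l : ι → ℝ) (P : Matrix ι (Fin 2) ℝ) (z : ℝ) :
    dress (l ∘ e) (P.submatrix e id) z = dress l P z := by
  have h : resolv (l ∘ e) z = (resolv l z).submatrix e e :=
    (submatrix_diagonal_equiv (fun i => (l i + z)⁻¹) e).symm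
  rw [dress, dress, lyap_submatrix, inv_submatrix_equiv, h, transpose_submatrix,
    submatrix_mul_equiv, submatrix_mul_equiv, submatrix_mul_equiv, submatrix_id_id]

variable {U : Type*}

theorem lyap_fromRows (l : ι → ℝ) (P : Matrix ι (Fin 2) ℝ) (a : ℝ) (p : Matrix U (Fin 2) ℝ) :
    lyap (Sum.elim l fun _ => a) (fromRows P p) =
      fromBlocks (lyap l P) (resolv l a * P * pᵀ) (p * Pᵀ * resolv l a)
        ((2 * a)⁻¹ • (p * pᵀ)) := by
  ext i j
  rcases i with i | i <;> rcases j with j | j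
  · simp [lyap, mul_apply]
  · rw [fromBlocks_apply₁₂, Matrix.mul_assoc, resolv, diagonal_mul]
    simp [lyap, mul_apply, div_eq_mul_inv, mul_comm]
  · rw [fromBlocks_apply₂₁, resolv, mul_diagonal]
    simp [lyap, mul_apply, div_eq_mul_inv, add_comm]
  · simp [lyap, mul_apply, div_eq_mul_inv, ← two_mul, mul_comm]

/-- The vector along which a new row `p` with parameter `a` enters the dressing matrix. -/
def newVec (l : ι → ℝ) (P : Matrix ι (Fin 2) ℝ) (a : ℝ) (p : Matrix U (Fin 2) ℝ) :
    Matrix (Fin 2) U ℝ := dress l P a * pᵀ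

variable {l : ι → ℝ} {P : Matrix ι (Fin 2) ℝ} {a : ℝ} {p : Matrix U (Fin 2) ℝ}

/-- The case `u = z = a` of `dress_transpose_mul_dress`, sandwiched between `p` and `pᵀ`: the Schur
complement of the old block is `|q|² / (2a)` for the new vector `q`. -/
theorem schur_lyap (hl : ∀ i j, l i + l j ≠ 0) (hM : (lyap l P).det ≠ 0)
    (ha : ∀ i, l i + a ≠ 0) (ha0 : a ≠ 0) :
    (2 * a)⁻¹ • (p * pᵀ) - p * Pᵀ * resolv l a * (lyap l P)⁻¹ * (resolv l a * P * pᵀ) =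
      (2 * a)⁻¹ • ((newVec l P a p)ᵀ * newVec l P a p) := by
  have h := dress_transpose_mul_dress hl hM ha ha
  rw [newVec, transpose_mul, transpose_transpose, Matrix.mul_assoc p (dress l P a)ᵀ,
    ← Matrix.mul_assoc (dress l P a)ᵀ, h]
  simp only [Matrix.mul_sub, Matrix.sub_mul, Matrix.mul_smul, Matrix.smul_mul, Matrix.one_mul,
    smul_sub, smul_smul, ← two_mul]
  rw [inv_mul_cancel₀ (mul_ne_zero two_ne_zero ha0), one_smul]
  simp only [Matrix.mul_assoc]

theorem det_lyap_fromRows [Fintype U] [DecidableEq U] [Unique U]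
    (hl : ∀ i j, l i + l j ≠ 0)
    (hM : (lyap l P).det ≠ 0) (ha : ∀ i, l i + a ≠ 0) (ha0 : a ≠ 0) :
    (lyap (Sum.elim l fun _ => a) (fromRows P p)).det =
      (lyap l P).det * ((2 * a)⁻¹ * ((newVec l P a p)ᵀ * newVec l P a p) default default) := by
  let _ := invertibleOfIsUnitDet (lyap l P) (isUnit_iff_ne_zero.mpr hM)
  rw [lyap_fromRows, det_fromBlocks₁₁, invOf_eq_nonsing_inv, schur_lyap hl hM ha ha0, det_unique (n := U)]
  simp

/-- Block elimination in `M' X = (Λ' + z)⁻¹ P'`. At `z = 0` the elementary factor is the reflection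
in the line orthogonal to `q`; at general `z` it scales the `q`-direction by `(z - a) / (z + a)`. -/
theorem dress_fromRows [Fintype U] [DecidableEq U] [Unique U]
    (hl : ∀ i j, l i + l j ≠ 0)
    (hM : (lyap l P).det ≠ 0) (ha : ∀ i, l i + a ≠ 0) (ha0 : a ≠ 0)
    (hN : ((newVec l P a p)ᵀ * newVec l P a p) default default ≠ 0) {z : ℝ}
    (hz : ∀ i, l i + z ≠ 0) (haz : a + z ≠ 0) :
    dress (Sum.elim l fun _ => a) (fromRows P p) z =
      (1 - (2 * a / ((a + z) * ((newVec l P a p)ᵀ * newVec l P a p) default default)) •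
        (newVec l P a p * (newVec l P a p)ᵀ)) * dress l P z := by
  have hU : IsUnit (lyap l P).det := isUnit_iff_ne_zero.mpr hM
  set q := newVec l P a p with hq
  set N := (qᵀ * q) default default with hNdef
  have hqq : qᵀ * q = N • (1 : Matrix U U ℝ) := by
    ext i j
    rw [Subsingleton.elim i default, Subsingleton.elim j default]
    simp [hNdef]
  have hdet : IsUnit (lyap (Sum.elim l fun _ => a) (fromRows P p)).det := by
    rw [det_lyap_fromRows hl hM ha ha0, isUnit_iff_ne_zero]
    exact mul_ne_zero hM (mul_ne_zero (inv_ne_zero (mul_ne_zero two_ne_zero ha0)) hN)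
  -- `r` is the new row of the solution `X`, read off from the Schur complement; `Y` is the solution
  -- without the new index.
  set r : Matrix U (Fin 2) ℝ := (2 * a / ((a + z) * N)) • (qᵀ * dress l P z) with hr
  set Y := (lyap l P)⁻¹ * (resolv l z * P) with hY
  have hqG : qᵀ * dress l P z = p - (a + z) • (p * Pᵀ * resolv l a * Y) := by
    rw [hq, newVec, transpose_mul, transpose_transpose, Matrix.mul_assoc,
      dress_transpose_mul_dress hl hM ha hz, Matrix.mul_sub, Matrix.mul_one, Matrix.mul_smul, hY]
    simp only [Matrix.mul_assoc]
  have hres : resolv (Sum.elim l fun _ : U => a) z * fromRows P p =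
      fromRows (resolv l z * P) ((a + z)⁻¹ • p) := by
    ext i j
    rcases i with i | i <;> simp [resolv, diagonal_mul]
  have hsol : lyap (Sum.elim l fun _ => a) (fromRows P p) *
      fromRows (Y - (lyap l P)⁻¹ * (resolv l a * P * pᵀ) * r) r =
      resolv (Sum.elim l fun _ : U => a) z * fromRows P p := by
    rw [hres, lyap_fromRows, fromBlocks_mul_fromRows]
    congr 1
    · rw [Matrix.mul_sub, hY, ← Matrix.mul_assoc (lyap l P), ← Matrix.mul_assoc (lyap l P),
        ← Matrix.mul_assoc (lyap l P), mul_nonsing_inv _ hU, Matrix.one_mul, Matrix.one_mul,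
        sub_add_cancel]
    · have e := schur_lyap (p := p) hl hM ha ha0
      rw [← hq, hqq, sub_eq_iff_eq_add] at e
      rw [e, Matrix.mul_sub, Matrix.add_mul, Matrix.smul_mul, Matrix.smul_mul, Matrix.one_mul]
      have e3 : (2 * a)⁻¹ • N • r = (a + z)⁻¹ • (qᵀ * dress l P z) := by
        rw [hr, smul_smul, smul_smul]
        congr 1
        field_simp
      rw [e3, hqG, smul_sub, smul_smul, inv_mul_cancel₀ haz, one_smul]
      simp only [Matrix.mul_assoc]
      abel
  have hinv : (lyap (Sum.elim l fun _ => a) (fromRows P p))⁻¹ *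
      (resolv (Sum.elim l fun _ : U => a) z * fromRows P p) =
      fromRows (Y - (lyap l P)⁻¹ * (resolv l a * P * pᵀ) * r) r := by
    rw [← hsol, ← Matrix.mul_assoc, nonsing_inv_mul _ hdet, Matrix.one_mul]
  have hG : dress (Sum.elim l fun _ => a) (fromRows P p) z = dress l P z - q * r := by
    rw [dress, Matrix.mul_assoc, Matrix.mul_assoc, hinv, transpose_fromRows,
      fromCols_mul_fromRows, dress, hq, newVec, dress, hY]
    simp only [Matrix.mul_sub, Matrix.sub_mul, Matrix.one_mul, Matrix.mul_assoc]
    abel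
  rw [hG, hr, Matrix.sub_mul, Matrix.one_mul, Matrix.mul_smul, Matrix.smul_mul, Matrix.mul_assoc]

end Lyapunov

end CAE

namespace CAE

open Matrix

/-! ### Adjoining an index, up to reindexing -/

section Lyapunov

variable {ι κ U : Type*} [Fintype ι] [DecidableEq ι] [Fintype κ] [DecidableEq κ]
  [Fintype U] [DecidableEq U] [Unique U]
  {l : ι → ℝ} {P : Matrix ι (Fin 2) ℝ} {a : ℝ} {p : Matrix U (Fin 2) ℝ}
  {l' : κ → ℝ} {P' : Matrix κ (Fin 2) ℝ} {e : ι ⊕ U ≃ κ}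

theorem det_lyap_extend (hl' : l' ∘ e = Sum.elim l fun _ => a)
    (hP' : P'.submatrix e id = fromRows P p) (hl : ∀ i j, l i + l j ≠ 0)
    (hM : (lyap l P).det ≠ 0) (ha : ∀ i, l i + a ≠ 0) (ha0 : a ≠ 0) :
    (lyap l' P').det =
      (lyap l P).det * ((2 * a)⁻¹ * ((newVec l P a p)ᵀ * newVec l P a p) default default) := by
  rw [← det_lyap_fromRows hl hM ha ha0, ← hl', ← hP', lyap_submatrix, det_submatrix_equiv_self]

theorem dress_extend (hl' : l' ∘ e = Sum.elim l fun _ => a)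
    (hP' : P'.submatrix e id = fromRows P p) (hl : ∀ i j, l i + l j ≠ 0)
    (hM : (lyap l P).det ≠ 0) (ha : ∀ i, l i + a ≠ 0) (ha0 : a ≠ 0)
    (hM' : (lyap l' P').det ≠ 0) {z : ℝ} (hz : ∀ i, l i + z ≠ 0) (haz : a + z ≠ 0) :
    dress l' P' z =
      (1 - (2 * a / ((a + z) * ((newVec l P a p)ᵀ * newVec l P a p) default default)) •
        (newVec l P a p * (newVec l P a p)ᵀ)) * dress l P z := by
  rw [det_lyap_extend hl' hP' hl hM ha ha0] at hM'
  rw [← dress_submatrix e, hl', hP',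
    dress_fromRows hl hM ha ha0 (right_ne_zero_of_mul (right_ne_zero_of_mul hM')) hz haz]

end Lyapunov

/-! ### Rotations and reflections of the plane -/

open Real

/-- The rotation by `-ω`, times the `j`-th power of a fixed reflection. -/
def rotRefl (ω : ℝ) (j : ℕ) : Matrix (Fin 2) (Fin 2) ℝ :=
  !![cos ω, sin ω; -sin ω, cos ω] * !![1, 0; 0, -1] ^ j

/-- The reflection in the line orthogonal to `(sin (ψ / 2), cos (ψ / 2))`. -/
def mirror (ψ : ℝ) : Matrix (Fin 2) (Fin 2) ℝ := !![cos ψ, -sin ψ; -sin ψ, -cos ψ]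

/-- Hence the mirror carrying angle `ω` to angle `ω₁` has `ψ = ω + ω₁`. -/
theorem mirror_mul_rotRefl (ψ ω : ℝ) (j : ℕ) :
    mirror ψ * rotRefl ω j = rotRefl (ψ - ω) (j + 1) := by
  rw [rotRefl, rotRefl, pow_succ', ← Matrix.mul_assoc, ← Matrix.mul_assoc]
  congr 1
  rw [mirror, cos_sub, sin_sub]
  ext i j
  fin_cases i <;> fin_cases j <;> simp [Matrix.mul_apply, Fin.sum_univ_two] <;> ring

theorem isUnit_det_rotRefl (ω : ℝ) (j : ℕ) : IsUnit (rotRefl ω j).det := by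
  have h : cos ω * cos ω + sin ω * sin ω = 1 := by
    linear_combination sin_sq_add_cos_sq ω
  rw [rotRefl, det_mul, det_pow, det_fin_two_of, det_fin_two_of]
  simp [h]

variable {q q₁ q₂ : Matrix (Fin 2) (Fin 1) ℝ}

theorem transpose_mul_self_apply (q : Matrix (Fin 2) (Fin 1) ℝ) :
    (qᵀ * q) default default = q 0 0 ^ 2 + q 1 0 ^ 2 := by
  simp [Matrix.mul_apply, sq]

theorem one_sub_smul_mul_transpose (t : ℝ) (q : Matrix (Fin 2) (Fin 1) ℝ) :
    1 - t • (q * qᵀ) = !![1 - t * (q 0 0 * q 0 0), -(t * (q 0 0 * q 1 0));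
      -(t * (q 0 0 * q 1 0)), 1 - t * (q 1 0 * q 1 0)] := by
  ext i j
  fin_cases i <;> fin_cases j <;> simp [Matrix.mul_apply, mul_comm]

theorem refl_eq_mirror {r κ : ℝ} (hr : r ≠ 0) (h0 : q 0 0 = r * sin κ) (h1 : q 1 0 = r * cos κ) :
    1 - (2 / (qᵀ * q) default default) • (q * qᵀ) = mirror (2 * κ) := by
  have hN : (qᵀ * q) default default = r ^ 2 := by
    rw [transpose_mul_self_apply, h0, h1]
    linear_combination r ^ 2 * sin_sq_add_cos_sq κ
  rw [one_sub_smul_mul_transpose, hN, mirror, h0, h1, sin_two_mul, cos_two_mul]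
  have h := sin_sq_add_cos_sq κ
  ext i j
  fin_cases i <;> fin_cases j <;> simp <;> field_simp
  linear_combination -2 * h

/-- A reflection determines its normal line, here that of the mirror with `ψ = ω + ω₁`. Only the
scalar `r`, including its sign, stays free. -/
theorem direction_of_refl {ω ω₁ : ℝ} {j : ℕ} (hN : (qᵀ * q) default default ≠ 0)
    (h : (1 - (2 / (qᵀ * q) default default) • (q * qᵀ)) * rotRefl ω j = rotRefl ω₁ (j + 1)) :
    ∃ r ≠ 0, q 0 0 = r * sin ((ω + ω₁) / 2) ∧ q 1 0 = r * cos ((ω + ω₁) / 2) := by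
  obtain ⟨κ, hκ⟩ : ∃ κ, κ = (ω + ω₁) / 2 := ⟨_, rfl⟩
  have e : rotRefl ω₁ (j + 1) = mirror (2 * κ) * rotRefl ω j := by
    rw [mirror_mul_rotRefl, hκ]
    congr 1
    ring
  rw [e] at h
  have h' := congrArg (· * (rotRefl ω j)⁻¹) h
  simp only [Matrix.mul_assoc, mul_nonsing_inv _ (isUnit_det_rotRefl ω j), Matrix.mul_one] at h'
  rw [one_sub_smul_mul_transpose, mirror, cos_two_mul, sin_two_mul] at h'
  have a00 := congrFun (congrFun h' 0) 0
  have a01 := congrFun (congrFun h' 0) 1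
  have a11 := congrFun (congrFun h' 1) 1
  simp only [of_apply, cons_val_zero, cons_val_one, cons_val', cons_val_fin_one] at a00 a01 a11
  rw [← hκ]
  have hpyth := sin_sq_add_cos_sq κ
  set N := (qᵀ * q) default default with hNd
  have hN' : N = q 0 0 ^ 2 + q 1 0 ^ 2 := transpose_mul_self_apply q
  clear_value N
  field_simp at a00 a01 a11
  -- The component of `q` across the expected direction; the entries of the matrix equation force
  -- its square to vanish.
  have hz : q 0 0 * cos κ - q 1 0 * sin κ = 0 := by
    have : (q 0 0 * cos κ - q 1 0 * sin κ) ^ 2 = 0 := by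
      linear_combination (-cos κ ^ 2 / 2) * a00 + 2 * sin κ * cos κ * a01 - sin κ ^ 2 / 2 * a11
        - N * cos κ ^ 2 * hpyth
    exact pow_eq_zero_iff two_ne_zero |>.mp this
  refine ⟨q 0 0 * sin κ + q 1 0 * cos κ, fun hr => hN ?_, ?_, ?_⟩
  · rw [hN']
    linear_combination -(q 0 0 ^ 2 + q 1 0 ^ 2) * hpyth + (q 0 0 * sin κ + q 1 0 * cos κ) * hr
      + (q 0 0 * cos κ - q 1 0 * sin κ) * hz
  · linear_combination -q 0 0 * hpyth + cos κ * hz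
  · linear_combination -q 1 0 * hpyth - sin κ * hz

/-- The superposition formula for reflections. -/
theorem superposition_refl {l m ω ω₁ ω₂ : ℝ} {j : ℕ} (hlm : l ^ 2 ≠ m ^ 2)
    (hN₁ : (q₁ᵀ * q₁) default default ≠ 0) (hN₂ : (q₂ᵀ * q₂) default default ≠ 0)
    (h₁ : (1 - (2 / (q₁ᵀ * q₁) default default) • (q₁ * q₁ᵀ)) * rotRefl ω j =
      rotRefl ω₁ (j + 1))
    (h₂ : (1 - (2 / (q₂ᵀ * q₂) default default) • (q₂ * q₂ᵀ)) * rotRefl ω j =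
      rotRefl ω₂ (j + 1))
    (hq : q = (1 - (2 * l / ((l + m) * (q₁ᵀ * q₁) default default)) • (q₁ * q₁ᵀ)) * q₂) :
    (qᵀ * q) default default =
      (q₂ᵀ * q₂) default default * (quadDen l m (ω₁ - ω₂) / (l + m) ^ 2) ∧
    (1 - (2 / (qᵀ * q) default default) • (q * qᵀ)) * rotRefl ω₁ (j + 1) =
      rotRefl (ω + 2 * supAngle ((l + m) / (l - m)) ((ω₁ - ω₂) / 2)) (j + 2) := by
  obtain ⟨r₁, hr₁, x₁, y₁⟩ := direction_of_refl hN₁ h₁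
  obtain ⟨r₂, hr₂, x₂, y₂⟩ := direction_of_refl hN₂ h₂
  have hm := sq_ne_sq_sub hlm
  have hp := sq_ne_sq_add hlm
  obtain ⟨κ, hκ⟩ : ∃ κ, κ = (ω + ω₁) / 2 := ⟨_, rfl⟩
  obtain ⟨θ, hθ⟩ : ∃ θ, θ = (ω₁ - ω₂) / 2 := ⟨_, rfl⟩
  rw [← hκ] at x₁ y₁
  rw [show (ω + ω₂) / 2 = κ - θ by rw [hκ, hθ]; ring] at x₂ y₂
  have pκ := sin_sq_add_cos_sq κ
  have pθ := sin_sq_add_cos_sq θ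
  have n₁ : (q₁ᵀ * q₁) default default = r₁ ^ 2 := by
    rw [transpose_mul_self_apply, x₁, y₁]
    linear_combination r₁ ^ 2 * pκ
  have n₂ : (q₂ᵀ * q₂) default default = r₂ ^ 2 := by
    rw [transpose_mul_self_apply, x₂, y₂]
    linear_combination r₂ ^ 2 * sin_sq_add_cos_sq (κ - θ)
  rw [n₁, one_sub_smul_mul_transpose] at hq
  -- `q₁` points along angle `κ` and `q₂` along `κ - θ`, angles being measured from the second axis.
  -- The factor scales the component along `q₁` by `(m - l) / (l + m)` and keeps the orthogonal one.
  have qx : q 0 0 = r₂ / (l + m) *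
      ((m - l) * cos θ * sin κ - (l + m) * sin θ * cos κ) := by
    rw [hq, Matrix.mul_apply, Fin.sum_univ_two]
    simp only [of_apply, cons_val_zero, cons_val_one, cons_val', cons_val_fin_one]
    rw [x₁, x₂, y₁, y₂, sin_sub, cos_sub]
    field_simp
    linear_combination -2 * l * sin κ * cos θ * pκ
  have qy : q 1 0 = r₂ / (l + m) *
      ((m - l) * cos θ * cos κ + (l + m) * sin θ * sin κ) := by
    rw [hq, Matrix.mul_apply, Fin.sum_univ_two]
    simp only [of_apply, cons_val_zero, cons_val_one, cons_val', cons_val_fin_one]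
    rw [x₁, x₂, y₁, y₂, sin_sub, cos_sub]
    field_simp
    linear_combination -2 * l * cos κ * cos θ * pκ
  have hN : (qᵀ * q) default default =
      (q₂ᵀ * q₂) default default * (quadDen l m (ω₁ - ω₂) / (l + m) ^ 2) := by
    rw [n₂, transpose_mul_self_apply, qx, qy, show ω₁ - ω₂ = 2 * θ by rw [hθ]; ring, quadDen_eq]
    field_simp
    linear_combination ((m - l) ^ 2 * cos θ ^ 2 + (l + m) ^ 2 * sin θ ^ 2) * pκ
  refine ⟨hN, ?_⟩
  rw [← hθ]
  have hk := div_ne_zero hp hm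
  have hsup := supAngle_spec hk θ
  set L := supAngle ((l + m) / (l - m)) θ
  have hsup' : (l - m) * sin L * cos θ = (l + m) * sin θ * cos L := by
    field_simp at hsup
    linear_combination hsup
  have pL := sin_sq_add_cos_sq (κ + L)
  -- The tangent of the angle from `q₁` to `q` is `(l + m) / (l - m) * tan θ`, so `q` lies along `κ
  -- + L`. Reflecting `ω₁` then gives `2 (κ + L) - ω₁ = ω + 2 L`.
  have hz : q 0 0 * cos (κ + L) - q 1 0 * sin (κ + L) = 0 := by
    rw [qx, qy, cos_add, sin_add]
    linear_combination r₂ / (l + m) * (sin κ ^ 2 + cos κ ^ 2) * hsup'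
  have hρ : q 0 0 * sin (κ + L) + q 1 0 * cos (κ + L) ≠ 0 := by
    intro h0
    have : (qᵀ * q) default default = 0 := by
      rw [transpose_mul_self_apply]
      linear_combination -(q 0 0 ^ 2 + q 1 0 ^ 2) * pL
        + (q 0 0 * sin (κ + L) + q 1 0 * cos (κ + L)) * h0
        + (q 0 0 * cos (κ + L) - q 1 0 * sin (κ + L)) * hz
    rw [hN] at this
    exact mul_ne_zero hN₂ (div_ne_zero (quadDen_pos hlm _).ne' (pow_ne_zero 2 hp)) this
  rw [refl_eq_mirror (κ := κ + L) hρ (by linear_combination -q 0 0 * pL + cos (κ + L) * hz)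
    (by linear_combination -q 1 0 * pL - sin (κ + L) * hz), mirror_mul_rotRefl]
  congr 1
  rw [hκ]
  ring

end CAE

namespace CAE

open Matrix Real

variable {n : ℕ} {lam : ℕ → ℝ}

/-! ### The matrices of the Bianchi lattice -/

/-- The parameters `lam_s, …, lam_{s+j-1}`. -/
def latPar (lam : ℕ → ℝ) (s j : ℕ) : Fin j → ℝ := fun p => lam (s + p)

/-- The row vector `(√a_i, 1 / √a_i)`. -/
def latVec (lam c : ℕ → ℝ) (ξ η : ℝ) (i : ℕ) : Matrix (Fin 1) (Fin 2) ℝ :=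
  of fun _ => ![√(expo lam c i ξ η), 1 / √(expo lam c i ξ η)]

/-- The matrix with rows `latVec` for the indices `s, …, s+j-1`. -/
def latRows (lam c : ℕ → ℝ) (ξ η : ℝ) (s j : ℕ) : Matrix (Fin j) (Fin 2) ℝ :=
  of fun p => ![√(expo lam c (s + p) ξ η), 1 / √(expo lam c (s + p) ξ η)]

theorem cauchyMatrix_eq_lyap (lam c : ℕ → ℝ) (ξ η : ℝ) (s j : ℕ) :
    cauchyMatrix lam c s j ξ η = lyap (latPar lam s j) (latRows lam c ξ η s j) := by
  ext p q
  simp only [cauchyMatrix, lyap, latPar, latRows, of_apply, Matrix.mul_apply, Fin.sum_univ_two,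
    transpose_apply, cons_val_zero, cons_val_one]
  rw [sqrt_mul (expo_pos _ _ _ _ _).le, one_div_mul_one_div, one_div_mul_eq_div]

/-- Splitting off the last index. -/
def lastEquiv (j : ℕ) : Fin j ⊕ Fin 1 ≃ Fin (j + 1) := finSumFinEquiv

/-- Splitting off the first index. -/
def firstEquiv (j : ℕ) : Fin j ⊕ Fin 1 ≃ Fin (j + 1) :=
  (Equiv.sumComm _ _).trans (finSumFinEquiv.trans (finCongr (add_comm 1 j)))

theorem latPar_lastEquiv (lam : ℕ → ℝ) (s j : ℕ) :
    latPar lam s (j + 1) ∘ lastEquiv j = Sum.elim (latPar lam s j) fun _ => lam (s + j) := by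
  funext i
  rcases i with i | i <;> simp [latPar, lastEquiv]

theorem latRows_lastEquiv (lam c : ℕ → ℝ) (ξ η : ℝ) (s j : ℕ) :
    (latRows lam c ξ η s (j + 1)).submatrix (lastEquiv j) id =
      fromRows (latRows lam c ξ η s j) (latVec lam c ξ η (s + j)) := by
  ext i k
  rcases i with i | i <;> simp [latRows, latVec, lastEquiv]

theorem latPar_firstEquiv (lam : ℕ → ℝ) (s j : ℕ) :
    latPar lam s (j + 1) ∘ firstEquiv j = Sum.elim (latPar lam (s + 1) j) fun _ => lam s := by
  funext i
  rcases i with i | i <;> simp [latPar, firstEquiv, add_assoc, add_comm 1]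

theorem latRows_firstEquiv (lam c : ℕ → ℝ) (ξ η : ℝ) (s j : ℕ) :
    (latRows lam c ξ η s (j + 1)).submatrix (firstEquiv j) id =
      fromRows (latRows lam c ξ η (s + 1) j) (latVec lam c ξ η s) := by
  ext i k
  rcases i with i | i <;> simp [latRows, latVec, firstEquiv, add_assoc, add_comm 1]

namespace GenericParams

theorem add_ne_zero (hg : GenericParams n lam) {i j : ℕ} (hi : 1 ≤ i) (hi' : i ≤ n) (hj : 1 ≤ j)
    (hj' : j ≤ n) : lam i + lam j ≠ 0 := by
  rcases lt_trichotomy i j with h | rfl | h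
  · exact sq_ne_sq_add (hg.sq_ne i j hi h hj')
  · rw [← two_mul]
    exact mul_ne_zero two_ne_zero (hg.ne_zero i hi hi')
  · exact sq_ne_sq_add (hg.sq_ne j i hj h hi').symm

theorem latPar_add_ne_zero (hg : GenericParams n lam) {s j i : ℕ} (hs : 1 ≤ s)
    (hj : s + j ≤ n + 1) (hi : 1 ≤ i) (hi' : i ≤ n) (k : Fin j) : latPar lam s j k + lam i ≠ 0 :=
  hg.add_ne_zero (by omega) (by omega) hi hi'

theorem latPar_add_latPar (hg : GenericParams n lam) {s j : ℕ} (hs : 1 ≤ s)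
    (hj : s + j ≤ n + 1) (k k' : Fin j) : latPar lam s j k + latPar lam s j k' ≠ 0 :=
  hg.latPar_add_ne_zero hs hj (by omega) (by omega) k

theorem latPar_add_zero (hg : GenericParams n lam) {s j : ℕ} (hs : 1 ≤ s)
    (hj : s + j ≤ n + 1) (k : Fin j) : latPar lam s j k + 0 ≠ 0 := by
  rw [add_zero]
  exact hg.ne_zero _ (by omega) (by omega)

end GenericParams

/-- The dressing matrix of an interval of the lattice. -/
def latDress (lam c : ℕ → ℝ) (ξ η : ℝ) (s j : ℕ) (z : ℝ) : Matrix (Fin 2) (Fin 2) ℝ :=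
  dress (latPar lam s j) (latRows lam c ξ η s j) z

/-- The vector along which the index `i` enters the dressing matrix of an interval. -/
def latNewVec (lam c : ℕ → ℝ) (ξ η : ℝ) (s j i : ℕ) : Matrix (Fin 2) (Fin 1) ℝ :=
  newVec (latPar lam s j) (latRows lam c ξ η s j) (lam i) (latVec lam c ξ η i)

section

variable (hg : GenericParams n lam) (c : ℕ → ℝ) (ξ η : ℝ) {s j : ℕ}
include hg

theorem det_last (hs : 1 ≤ s) (hj : s + (j + 1) ≤ n + 1)
    (hM : (cauchyMatrix lam c s j ξ η).det ≠ 0) :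
    (cauchyMatrix lam c s (j + 1) ξ η).det = (cauchyMatrix lam c s j ξ η).det *
      ((2 * lam (s + j))⁻¹ * ((latNewVec lam c ξ η s j (s + j))ᵀ *
        latNewVec lam c ξ η s j (s + j)) default default) := by
  rw [cauchyMatrix_eq_lyap] at *
  rw [cauchyMatrix_eq_lyap]
  exact det_lyap_extend (latPar_lastEquiv lam s j) (latRows_lastEquiv lam c ξ η s j)
    (hg.latPar_add_latPar hs (by omega)) hM
    (hg.latPar_add_ne_zero hs (by omega) (by omega) (by omega))
    (hg.ne_zero _ (by omega) (by omega))

theorem det_first (hs : 1 ≤ s) (hj : s + (j + 1) ≤ n + 1)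
    (hM : (cauchyMatrix lam c (s + 1) j ξ η).det ≠ 0) :
    (cauchyMatrix lam c s (j + 1) ξ η).det = (cauchyMatrix lam c (s + 1) j ξ η).det *
      ((2 * lam s)⁻¹ * ((latNewVec lam c ξ η (s + 1) j s)ᵀ *
        latNewVec lam c ξ η (s + 1) j s) default default) := by
  rw [cauchyMatrix_eq_lyap] at *
  rw [cauchyMatrix_eq_lyap]
  exact det_lyap_extend (latPar_firstEquiv lam s j) (latRows_firstEquiv lam c ξ η s j)
    (hg.latPar_add_latPar (by omega) (by omega)) hM
    (hg.latPar_add_ne_zero (by omega) (by omega) (by omega) (by omega))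
    (hg.ne_zero _ (by omega) (by omega))

theorem latDress_zero_last (hs : 1 ≤ s) (hj : s + (j + 1) ≤ n + 1)
    (hM : (cauchyMatrix lam c s j ξ η).det ≠ 0)
    (hM' : (cauchyMatrix lam c s (j + 1) ξ η).det ≠ 0) :
    latDress lam c ξ η s (j + 1) 0 = (1 - (2 / ((latNewVec lam c ξ η s j (s + j))ᵀ *
      latNewVec lam c ξ η s j (s + j)) default default) •
        (latNewVec lam c ξ η s j (s + j) * (latNewVec lam c ξ η s j (s + j))ᵀ)) *
      latDress lam c ξ η s j 0 := by
  have h0 := hg.ne_zero (s + j) (by omega) (by omega)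
  rw [cauchyMatrix_eq_lyap] at hM hM'
  have := dress_extend (latPar_lastEquiv lam s j) (latRows_lastEquiv lam c ξ η s j)
    (hg.latPar_add_latPar hs (by omega)) hM
    (hg.latPar_add_ne_zero hs (by omega) (by omega) (by omega)) h0 hM'
    (hg.latPar_add_zero hs (by omega)) (by rwa [add_zero])
  rw [add_zero, mul_comm 2, mul_div_mul_left _ _ h0] at this
  exact this

theorem latDress_first (hs : 1 ≤ s) (hj : s + (j + 1) ≤ n + 1)
    (hM : (cauchyMatrix lam c (s + 1) j ξ η).det ≠ 0)
    (hM' : (cauchyMatrix lam c s (j + 1) ξ η).det ≠ 0) {z : ℝ}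
    (hz : ∀ i, latPar lam (s + 1) j i + z ≠ 0) (haz : lam s + z ≠ 0) :
    latDress lam c ξ η s (j + 1) z = (1 - (2 * lam s / ((lam s + z) *
      ((latNewVec lam c ξ η (s + 1) j s)ᵀ * latNewVec lam c ξ η (s + 1) j s) default default)) •
        (latNewVec lam c ξ η (s + 1) j s * (latNewVec lam c ξ η (s + 1) j s)ᵀ)) *
      latDress lam c ξ η (s + 1) j z := by
  rw [cauchyMatrix_eq_lyap] at hM hM'
  exact dress_extend (latPar_firstEquiv lam s j) (latRows_firstEquiv lam c ξ η s j)
    (hg.latPar_add_latPar (by omega) (by omega)) hM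
    (hg.latPar_add_ne_zero (by omega) (by omega) (by omega) (by omega))
    (hg.ne_zero _ (by omega) (by omega)) hM' hz haz

end

theorem det_cauchyMatrix_zero (lam c : ℕ → ℝ) (ξ η : ℝ) (s : ℕ) :
    (cauchyMatrix lam c s 0 ξ η).det = 1 := det_isEmpty

theorem det_cauchyMatrix_one (lam c : ℕ → ℝ) (ξ η : ℝ) (s : ℕ) :
    (cauchyMatrix lam c s 1 ξ η).det =
      (2 * lam s)⁻¹ * (expo lam c s ξ η + 1 / expo lam c s ξ η) := by
  rw [det_fin_one]
  simp [cauchyMatrix, sqrt_mul_self (expo_pos lam c s ξ η).le, two_mul]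

theorem latDress_zero (lam c : ℕ → ℝ) (ξ η : ℝ) (s : ℕ) (z : ℝ) :
    latDress lam c ξ η s 0 z = 1 := by
  rw [latDress, dress]
  ext i j
  simp

/-- The determinants satisfy a recursion along the Bianchi quadrilaterals, and the dressing
matrices at `0` follow the superposition formula. -/
theorem lattice_step (hg : GenericParams n lam) (c : ℕ → ℝ) (ξ η : ℝ) {s j : ℕ} (hs : 1 ≤ s)
    (hj : s + (j + 2) ≤ n + 1) (hM : (cauchyMatrix lam c (s + 1) j ξ η).det ≠ 0)
    (hM₁ : (cauchyMatrix lam c s (j + 1) ξ η).det ≠ 0)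
    (hM₂ : (cauchyMatrix lam c (s + 1) (j + 1) ξ η).det ≠ 0)
    (hR : latDress lam c ξ η (s + 1) j 0 = rotRefl (omega lam c (s + 1) j ξ η) j)
    (hR₁ : latDress lam c ξ η s (j + 1) 0 = rotRefl (omega lam c s (j + 1) ξ η) (j + 1))
    (hR₂ : latDress lam c ξ η (s + 1) (j + 1) 0 =
      rotRefl (omega lam c (s + 1) (j + 1) ξ η) (j + 1)) :
    (cauchyMatrix lam c s (j + 2) ξ η).det * (cauchyMatrix lam c (s + 1) j ξ η).det =
      (cauchyMatrix lam c s (j + 1) ξ η).det * (cauchyMatrix lam c (s + 1) (j + 1) ξ η).det *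
        (quadDen (lam s) (lam (s + j + 1))
          (omega lam c s (j + 1) ξ η - omega lam c (s + 1) (j + 1) ξ η) /
          (lam s + lam (s + j + 1)) ^ 2) ∧
    (cauchyMatrix lam c s (j + 2) ξ η).det ≠ 0 ∧
    latDress lam c ξ η s (j + 2) 0 = rotRefl (omega lam c s (j + 2) ξ η) (j + 2) := by
  have hl := hg.ne_zero s hs (by omega)
  have hm := hg.ne_zero (s + j + 1) (by omega) (by omega)
  have hlm := hg.sq_ne s (s + j + 1) hs (by omega) (by omega)
  have hidx : s + 1 + j = s + j + 1 := by ring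
  have d₁ := det_first hg c ξ η hs (by omega) hM
  have d₂ := det_last hg c ξ η (s := s + 1) (by omega) (by omega) hM
  have d₁₂ := det_last hg c ξ η hs (j := j + 1) (by omega) hM₁
  have D₁ := latDress_first hg c ξ η hs (by omega) hM hM₁ (z := 0)
    (hg.latPar_add_zero (by omega) (by omega)) (by rwa [add_zero])
  have D₂ := latDress_zero_last hg c ξ η (s := s + 1) (by omega) (by omega) hM hM₂
  -- The last index now enters an interval already containing the first one: its vector is the old
  -- `q₂` acted on by the elementary factor of `q₁`, evaluated at `z = lam (s + j + 1)`.
  have hq : latNewVec lam c ξ η s (j + 1) (s + (j + 1)) =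
      (1 - (2 * lam s / ((lam s + lam (s + j + 1)) * ((latNewVec lam c ξ η (s + 1) j s)ᵀ *
        latNewVec lam c ξ η (s + 1) j s) default default)) •
        (latNewVec lam c ξ η (s + 1) j s * (latNewVec lam c ξ η (s + 1) j s)ᵀ)) *
      latNewVec lam c ξ η (s + 1) j (s + 1 + j) := by
    have := latDress_first hg c ξ η hs (by omega) hM hM₁ (z := lam (s + j + 1))
      (hg.latPar_add_ne_zero (by omega) (by omega) (by omega) (by omega)) (sq_ne_sq_add hlm)
    rw [latNewVec, newVec, ← latDress, ← add_assoc, this, latNewVec.eq_1 (i := s + 1 + j),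
      newVec.eq_1 (a := lam (s + 1 + j)), ← latDress, hidx, Matrix.mul_assoc]
  rw [hidx] at d₂ D₂ hq
  generalize latNewVec lam c ξ η (s + 1) j s = q₁ at *
  generalize latNewVec lam c ξ η (s + 1) j (s + j + 1) = q₂ at *
  have hN₁ : (q₁ᵀ * q₁) default default ≠ 0 := by
    rw [d₁] at hM₁
    exact right_ne_zero_of_mul (right_ne_zero_of_mul hM₁)
  have hN₂ : (q₂ᵀ * q₂) default default ≠ 0 := by
    rw [d₂] at hM₂
    exact right_ne_zero_of_mul (right_ne_zero_of_mul hM₂)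
  rw [add_zero, mul_comm 2, mul_div_mul_left _ _ hl, hR, hR₁] at D₁
  rw [hR, hR₂] at D₂
  obtain ⟨hN, hD⟩ := superposition_refl hlm hN₁ hN₂ D₁.symm D₂.symm hq
  have hp := (quadDen_pos hlm
    (omega lam c s (j + 1) ξ η - omega lam c (s + 1) (j + 1) ξ η)).ne'
  have hlm' := sq_ne_sq_add hlm
  have hrec : (cauchyMatrix lam c s (j + 2) ξ η).det * (cauchyMatrix lam c (s + 1) j ξ η).det =
      (cauchyMatrix lam c s (j + 1) ξ η).det * (cauchyMatrix lam c (s + 1) (j + 1) ξ η).det *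
        (quadDen (lam s) (lam (s + j + 1))
          (omega lam c s (j + 1) ξ η - omega lam c (s + 1) (j + 1) ξ η) /
          (lam s + lam (s + j + 1)) ^ 2) := by
    rw [d₁₂, d₂, hN, ← add_assoc]
    ring
  have hM₁₂ : (cauchyMatrix lam c s (j + 2) ξ η).det ≠ 0 := by
    refine left_ne_zero_of_mul (b := (cauchyMatrix lam c (s + 1) j ξ η).det) ?_
    rw [hrec]
    exact mul_ne_zero (mul_ne_zero hM₁ hM₂) (div_ne_zero hp (pow_ne_zero 2 hlm'))
  refine ⟨hrec, hM₁₂, ?_⟩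
  rw [latDress_zero_last hg c ξ η hs (j := j + 1) (by omega) hM₁ hM₁₂, hR₁, hD, omega]

/-- The matrices are invertible, and the dressing matrix at `0` is the rotation or reflection
with angle `ω`. -/
theorem det_ne_zero_and_latDress_eq (hg : GenericParams n lam) (c : ℕ → ℝ) (ξ η : ℝ) (j : ℕ) :
    ∀ s, 1 ≤ s → s + j ≤ n + 1 → (cauchyMatrix lam c s j ξ η).det ≠ 0 ∧
      latDress lam c ξ η s j 0 = rotRefl (omega lam c s j ξ η) j := by
  induction j using Nat.twoStepInduction with
  | zero =>
    intro s _ _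
    rw [det_cauchyMatrix_zero, latDress_zero, omega_zero]
    refine ⟨one_ne_zero, ?_⟩
    ext i j
    fin_cases i <;> fin_cases j <;> simp [rotRefl]
  | one =>
    intro s hs hj
    have h0 := hg.ne_zero s hs (by omega)
    have ha := expo_pos lam c s ξ η
    have hM : (cauchyMatrix lam c s 1 ξ η).det ≠ 0 := by
      rw [det_cauchyMatrix_one]
      exact mul_ne_zero (inv_ne_zero (mul_ne_zero two_ne_zero h0)) (by positivity)
    refine ⟨hM, ?_⟩
    have hM0 : (cauchyMatrix lam c s 0 ξ η).det ≠ 0 := by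
      rw [det_cauchyMatrix_zero]
      exact one_ne_zero
    rw [latDress_zero_last hg c ξ η hs hj hM0 hM, latDress_zero, Matrix.mul_one]
    have hv : latNewVec lam c ξ η s 0 (s + 0) = (latVec lam c ξ η s)ᵀ := by
      rw [latNewVec, newVec, ← latDress, latDress_zero, Matrix.one_mul, add_zero]
    obtain ⟨t, ht⟩ : ∃ t, t = √(expo lam c s ξ η) := ⟨_, rfl⟩
    have hs' : 0 < t := ht ▸ sqrt_pos.mpr ha
    have e : expo lam c s ξ η = t ^ 2 := by rw [ht, sq_sqrt ha.le]
    have v0 : (latVec lam c ξ η s)ᵀ 0 0 = t := ht.symm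
    have v1 : (latVec lam c ξ η s)ᵀ 1 0 = 1 / t := by rw [ht]; rfl
    rw [hv, one_sub_smul_mul_transpose, transpose_mul_self_apply, v0, v1, rotRefl,
      cos_omega_one, sin_omega_one, e]
    ext i j
    fin_cases i <;> fin_cases j <;> simp <;> field_simp <;> ring
  | more j ih0 ih1 =>
    intro s hs hj
    obtain ⟨hM, hR⟩ := ih0 (s + 1) (by omega) (by omega)
    obtain ⟨hM1, hR1⟩ := ih1 s hs (by omega)
    obtain ⟨hM2, hR2⟩ := ih1 (s + 1) (by omega) (by omega)
    exact lattice_step hg c ξ η hs hj hM hM1 hM2 hR hR1 hR2 |>.2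

end CAE

namespace CAE

open Matrix Real

variable {n : ℕ} {lam : ℕ → ℝ}

/-! ### The logarithm of the determinant -/

theorem det_cauchyMatrix_ne_zero (hg : GenericParams n lam) (c : ℕ → ℝ) {s j : ℕ} (hs : 1 ≤ s)
    (hj : s + j ≤ n + 1) (ξ η : ℝ) : (cauchyMatrix lam c s j ξ η).det ≠ 0 :=
  (det_ne_zero_and_latDress_eq hg c ξ η j s hs hj).1

theorem det_recursion (hg : GenericParams n lam) (c : ℕ → ℝ) {s j : ℕ} (hs : 1 ≤ s)
    (hj : s + (j + 2) ≤ n + 1) (ξ η : ℝ) :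
    (cauchyMatrix lam c s (j + 2) ξ η).det * (cauchyMatrix lam c (s + 1) j ξ η).det =
      (cauchyMatrix lam c s (j + 1) ξ η).det * (cauchyMatrix lam c (s + 1) (j + 1) ξ η).det *
        (quadDen (lam s) (lam (s + j + 1))
          (omega lam c s (j + 1) ξ η - omega lam c (s + 1) (j + 1) ξ η) /
          (lam s + lam (s + j + 1)) ^ 2) := by
  obtain ⟨hM, hR⟩ := det_ne_zero_and_latDress_eq hg c ξ η j (s + 1) (by omega) (by omega)
  obtain ⟨hM₁, hR₁⟩ := det_ne_zero_and_latDress_eq hg c ξ η (j + 1) s hs (by omega)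
  obtain ⟨hM₂, hR₂⟩ := det_ne_zero_and_latDress_eq hg c ξ η (j + 1) (s + 1) (by omega) (by omega)
  exact (lattice_step hg c ξ η hs hj hM hM₁ hM₂ hR hR₁ hR₂).1

/-- `det_recursion` multiplies the ratio of determinants by `h` up to a constant, and `den_eta`
moves the cosine to the opposite edge. `Real.log` is the logarithm of the absolute value, so the
signs of the determinants are immaterial. -/
theorem log_det_ratio_eta (hg : GenericParams n lam) (c : ℕ → ℝ) (j : ℕ) :
    ∀ s, 1 ≤ s → s + (j + 1) ≤ n + 1 → ∀ ξ η,
      HasDerivAt (fun t => log (cauchyMatrix lam c s (j + 1) ξ t).det -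
        log (cauchyMatrix lam c (s + 1) j ξ t).det)
      (-(1 / lam s * cos (omega lam c s (j + 1) ξ η - omega lam c (s + 1) j ξ η))) η := by
  induction j with
  | zero =>
    intro s hs hj ξ η
    have hl := hg.ne_zero s hs (by omega)
    have ha := expo_pos lam c s ξ η
    have hd := det_cauchyMatrix_ne_zero hg c hs hj ξ η
    have he := expo_eta lam c s ξ η
    have h1 : ∀ t, (cauchyMatrix lam c s (0 + 1) ξ t).det =
        (2 * lam s)⁻¹ * (expo lam c s ξ t + 1 / expo lam c s ξ t) :=
      fun t => det_cauchyMatrix_one lam c ξ t s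
    simp only [zero_add, det_cauchyMatrix_zero, h1, log_one, sub_zero, omega_zero] at hd ⊢
    have := (((he.fun_add ((hasDerivAt_const η (1 : ℝ)).fun_div he ha.ne')).const_mul
      (2 * lam s)⁻¹).log hd)
    refine this.congr_deriv ?_
    rw [cos_omega_one]
    generalize expo lam c s ξ η = a at *
    field_simp
    ring
  | succ j ih =>
    intro s hs hj ξ η
    have q := bianchiQuad_omega hg c hs hj
    have h := ih s hs (by omega) ξ η
    have hp := q.den_pos ξ η
    have e : (fun t => log (cauchyMatrix lam c s (j + 1 + 1) ξ t).det -
        log (cauchyMatrix lam c (s + 1) (j + 1) ξ t).det) = fun t =>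
        (log (cauchyMatrix lam c s (j + 1) ξ t).det -
          log (cauchyMatrix lam c (s + 1) j ξ t).det) +
        (log (quadDen (lam s) (lam (s + j + 1))
          (omega lam c s (j + 1) ξ t - omega lam c (s + 1) (j + 1) ξ t)) -
          log ((lam s + lam (s + j + 1)) ^ 2)) := by
      funext t
      have hM := det_cauchyMatrix_ne_zero hg c (s := s + 1) (j := j) (by omega) (by omega) ξ t
      have hM₁ := det_cauchyMatrix_ne_zero hg c (s := s) (j := j + 1) hs (by omega) ξ t
      have hM₂ := det_cauchyMatrix_ne_zero hg c (s := s + 1) (j := j + 1) (by omega) (by omega) ξ t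
      have hM₁₂ := det_cauchyMatrix_ne_zero hg c (s := s) (j := j + 2) hs (by omega) ξ t
      have hr := congrArg log (det_recursion hg c hs hj ξ t)
      have hp' := (q.den_pos ξ t).ne'
      have hlm := pow_ne_zero 2 (sq_ne_sq_add q.sq_ne)
      rw [log_mul hM₁₂ hM, log_mul (mul_ne_zero hM₁ hM₂) (div_ne_zero hp' hlm),
        log_mul hM₁ hM₂, log_div hp' hlm] at hr
      linear_combination hr
    rw [e]
    refine (h.fun_add (((q.den_eta ξ η).log hp.ne').sub_const _)).congr_deriv ?_
    rw [mul_div_cancel_left₀ _ hp.ne']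
    ring

/-- Induction by removing the first index: the `ξ`-derivative of `-cos (ω' - ω) / l` is `sin (ω' -
ω) sin (ω' + ω) = sin² ω' - sin² ω`, so the sum telescopes down to the zero seed. -/
theorem log_det_mixed (hg : GenericParams n lam) (c : ℕ → ℝ) (j : ℕ) :
    ∀ s, 1 ≤ s → s + j ≤ n + 1 → ∃ f : ℝ → ℝ → ℝ, ∀ ξ η,
      HasDerivAt (fun t => log (cauchyMatrix lam c s j ξ t).det) (f ξ η) η ∧
      HasDerivAt (fun t => f t η) (sin (omega lam c s j ξ η) ^ 2) ξ := by
  induction j with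
  | zero =>
    intro s _ _
    refine ⟨fun _ _ => 0, fun ξ η => ?_⟩
    simp only [det_cauchyMatrix_zero, omega_zero, log_one, sin_zero]
    exact ⟨hasDerivAt_const _ _, by simpa using hasDerivAt_const ξ (0 : ℝ)⟩
  | succ j ih =>
    intro s hs hj
    have hl := hg.ne_zero s hs (by omega)
    obtain ⟨f, hf⟩ := ih (s + 1) (by omega) (by omega)
    refine ⟨fun ξ η => f ξ η +
      -(1 / lam s * cos (omega lam c s (j + 1) ξ η - omega lam c (s + 1) j ξ η)),
      fun ξ η => ⟨?_, ?_⟩⟩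
    · have := (hf ξ η).1.fun_add (log_det_ratio_eta hg c j s hs hj ξ η)
      simpa only [add_sub_cancel] using this
    · have h₁ := hasDerivAt_fst (contDiff_omega hg c hs hj) ξ η
      have h₀ := hasDerivAt_fst (contDiff_omega hg c (s := s + 1) (j := j)
        (by omega) (by omega)) ξ η
      rw [(backlund_omega hg c hs hj).1] at h₁
      refine ((hf ξ η).2.fun_add
        (((h₁.fun_sub h₀).cos.const_mul (1 / lam s)).fun_neg)).congr_deriv ?_
      have p₀ := sin_sq_add_cos_sq (omega lam c (s + 1) j ξ η)
      have p₁ := sin_sq_add_cos_sq (omega lam c s (j + 1) ξ η)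
      rw [sin_sub, sin_add]
      field_simp
      linear_combination lam s * sin (omega lam c s (j + 1) ξ η) ^ 2 * p₀
        - lam s * sin (omega lam c (s + 1) j ξ η) ^ 2 * p₁

theorem cos_two_mul_omega (hg : GenericParams n lam) (c : ℕ → ℝ) {s j : ℕ} (hs : 1 ≤ s)
    (hj : s + j ≤ n + 1) (ξ η : ℝ) : cos (2 * omega lam c s j ξ η) = phi lam c s j ξ η := by
  obtain ⟨f, hf⟩ := log_det_mixed hg c j s hs hj
  rw [phi, funext fun ξ' => (hf ξ' η).1.deriv, (hf ξ η).2.deriv, cos_two_mul']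
  linear_combination sin_sq_add_cos_sq (omega lam c s j ξ η)

/-! ### The matrices `S` -/

/-- Removes the roots from `S`; where `t = 0`, both the sign and the radicand vanish. -/
theorem signedSqrt_eq {k t r : ℝ} (hk : 0 ≤ k) (hr : r = (k * t) ^ 2) :
    signedSqrt t r = k * t := by
  rw [signedSqrt, hr, sqrt_sq_eq_abs, abs_mul, abs_of_nonneg hk]
  rcases lt_trichotomy t 0 with h | rfl | h
  · rw [sign_of_neg h, abs_of_neg h]
    ring
  · simp
  · rw [sign_of_pos h, abs_of_pos h]
    ring

section

variable (hg : GenericParams n lam) (c : ℕ → ℝ) {j : ℕ} (hj : j + 1 ≤ n) (ξ η : ℝ)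
include hg hj

theorem A_add_B_eq : A lam c j ξ η + B lam c j ξ η =
    2 * cos (2 * (omega lam c 2 j ξ η - omega lam c 1 j ξ η)) := by
  rw [A, B, ← cos_two_mul_omega hg c (by norm_num) (by omega),
    ← cos_two_mul_omega hg c le_rfl (by omega),
    signedSqrt_eq zero_le_one, mul_sub, cos_sub]
  · ring
  · rw [one_mul, mul_pow, sin_sq, sin_sq]
    ring

theorem rootMinus_eq : rootMinus lam c j ξ η =
    2 * sin (omega lam c 2 j ξ η - omega lam c 1 j ξ η) := by
  refine signedSqrt_eq zero_le_two ?_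
  rw [sub_sub, A_add_B_eq hg c hj, cos_two_mul', cos_sq']
  ring

theorem rootPlus_eq : rootPlus lam c j ξ η =
    2 * cos (omega lam c 2 j ξ η - omega lam c 1 j ξ η) := by
  refine signedSqrt_eq zero_le_two ?_
  rw [add_assoc, A_add_B_eq hg c hj, cos_two_mul]
  ring

theorem den_eq : lam 1 ^ 2 + lam (j + 1) ^ 2 - lam (j + 1) * lam 1 * rootPlus lam c j ξ η =
    quadDen (lam 1) (lam (j + 1)) (omega lam c 1 j ξ η - omega lam c 2 j ξ η) := by
  rw [rootPlus_eq hg c hj, quadDen, ← cos_neg, neg_sub]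
  ring

end

/-! ### The product of the matrices `S` and the soliton solutions -/

theorem stateVec_injective {x y g x' y' g' : ℝ → ℝ → ℝ}
    (h : ∀ ξ η, stateVec x y g ξ η = stateVec x' y' g' ξ η) : x = x' ∧ y = y' ∧ g = g' :=
  ⟨funext fun ξ => funext fun η => congrFun (h ξ η) 0,
    funext fun ξ => funext fun η => congrFun (h ξ η) 1,
    funext fun ξ => funext fun η => congrFun (h ξ η) 2⟩

theorem PotentialStep.stateVec_eq (hg : GenericParams n lam) (c : ℕ → ℝ) {j : ℕ} (hj : j + 1 ≤ n)
    {x y g x' y' g' : ℝ → ℝ → ℝ}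
    (p : PotentialStep (lam 1) (lam (j + 1)) (omega lam c 1 j) (omega lam c 2 j) x y g x' y' g')
    (ξ η : ℝ) : stateVec x' y' g' ξ η = (S lam c j ξ η).mulVec (stateVec x y g ξ η) := by
  ext i
  fin_cases i
  · simp [stateVec, S, Matrix.mulVec, dotProduct, Fin.sum_univ_four, p.x_eq, den_eq hg c hj,
      rootMinus_eq hg c hj]
    ring
  · simp [stateVec, S, Matrix.mulVec, dotProduct, Fin.sum_univ_four, p.y_eq, rootMinus_eq hg c hj]
    ring
  · simp [stateVec, S, S33, Matrix.mulVec, dotProduct, Fin.sum_univ_four, p.g_eq, den_eq hg c hj]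
  · simp [stateVec, S, S33, Matrix.mulVec, dotProduct, Fin.sum_univ_four, p.g_eq, den_eq hg c hj]
    ring

theorem exists_soliton_succ (hg : GenericParams n lam) (c : ℕ → ℝ) {j : ℕ} (hj : j + 2 ≤ n)
    {x y g : ℝ → ℝ → ℝ} (h : IsSolitonSolution lam c (j + 1) x y g) :
    ∃ x' y' g', IsSolitonSolution lam c (j + 2) x' y' g' ∧
      ∀ ξ η, stateVec x' y' g' ξ η = (S lam c (j + 1) ξ η).mulVec (stateVec x y g ξ η) := by
  have q := bianchiQuad_omega hg c (s := 1) (j := j) le_rfl (by omega)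
  rw [show 1 + j + 1 = j + 1 + 1 by ring] at q
  have p : PotentialStep (lam 1) (lam (j + 1 + 1)) (omega lam c 1 (j + 1)) (omega lam c 2 (j + 1))
    x y g _ _ _ := ⟨fun _ _ => rfl, fun _ _ => rfl, fun _ _ => rfl⟩
  exact ⟨_, _, _, p.associated_right q (isSineGordonSolution_omega hg c (by omega) (by omega))
    (isSineGordonSolution_omega hg c le_rfl (by omega)) h, p.stateVec_eq hg c hj⟩

theorem exists_soliton_pred (hg : GenericParams n lam) (c : ℕ → ℝ) {j : ℕ} (hj : j + 2 ≤ n)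
    {x' y' g' : ℝ → ℝ → ℝ} (h : IsSolitonSolution lam c (j + 2) x' y' g') :
    ∃ x y g, IsSolitonSolution lam c (j + 1) x y g ∧
      ∀ ξ η, stateVec x' y' g' ξ η = (S lam c (j + 1) ξ η).mulVec (stateVec x y g ξ η) := by
  have q := bianchiQuad_omega hg c (s := 1) (j := j) le_rfl (by omega)
  rw [show 1 + j + 1 = j + 1 + 1 by ring] at q
  have hl := q.l_ne
  have hm := q.m_ne
  have hlm : lam 1 ^ 2 - lam (j + 1 + 1) ^ 2 ≠ 0 := sub_ne_zero.mpr q.sq_ne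
  have hml : lam (j + 1 + 1) ^ 2 - lam 1 ^ 2 ≠ 0 := sub_ne_zero.mpr q.sq_ne.symm
  -- The candidate triple comes from solving the formulas of `PotentialStep` for the unprimed
  -- functions, beginning with `g`.
  let d : ℝ → ℝ → ℝ := fun ξ η => quadDen (lam 1) (lam (j + 1 + 1))
    (omega lam c 1 (j + 1) ξ η - omega lam c 2 (j + 1) ξ η)
  let σ : ℝ → ℝ → ℝ := fun ξ η => 2 * sin (omega lam c 2 (j + 1) ξ η - omega lam c 1 (j + 1) ξ η)
  let g : ℝ → ℝ → ℝ := fun ξ η => -(d ξ η * g' ξ η) / (lam (j + 1 + 1) * lam 1)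
  let x : ℝ → ℝ → ℝ := fun ξ η => (lam (j + 1 + 1) ^ 2 - lam 1 ^ 2) / (lam (j + 1 + 1) * lam 1) *
    x' ξ η + lam (j + 1 + 1) * lam 1 * (σ ξ η / d ξ η * g ξ η)
  let y : ℝ → ℝ → ℝ := fun ξ η => lam (j + 1 + 1) * lam 1 / (lam (j + 1 + 1) ^ 2 - lam 1 ^ 2) *
    (y' ξ η + σ ξ η / g ξ η)
  have p : PotentialStep (lam 1) (lam (j + 1 + 1)) (omega lam c 1 (j + 1)) (omega lam c 2 (j + 1))
      x y g x' y' g' := by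
    refine ⟨fun ξ η => ?_, fun ξ η => ?_, fun ξ η => ?_⟩
    · have hp : d ξ η ≠ 0 := (q.den_pos ξ η).ne'
      change g' ξ η = -(lam (j + 1 + 1) * lam 1) / d ξ η *
        (-(d ξ η * g' ξ η) / (lam (j + 1 + 1) * lam 1))
      field_simp
    · change x' ξ η = lam (j + 1 + 1) * lam 1 / (lam (j + 1 + 1) ^ 2 - lam 1 ^ 2) *
        ((lam (j + 1 + 1) ^ 2 - lam 1 ^ 2) / (lam (j + 1 + 1) * lam 1) *
          x' ξ η + lam (j + 1 + 1) * lam 1 * (σ ξ η / d ξ η * g ξ η)) +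
        lam (j + 1 + 1) ^ 2 * lam 1 ^ 2 / (lam 1 ^ 2 - lam (j + 1 + 1) ^ 2) *
          (σ ξ η / d ξ η * g ξ η)
      generalize σ ξ η / d ξ η * g ξ η = K
      rw [← neg_sub (lam (j + 1 + 1) ^ 2)]
      field_simp
      ring
    · change y' ξ η = (lam (j + 1 + 1) ^ 2 - lam 1 ^ 2) / (lam (j + 1 + 1) * lam 1) *
        (lam (j + 1 + 1) * lam 1 / (lam (j + 1 + 1) ^ 2 - lam 1 ^ 2) *
          (y' ξ η + σ ξ η / g ξ η)) - σ ξ η / g ξ η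
      generalize σ ξ η / g ξ η = K
      field_simp
      ring
  exact ⟨x, y, g, p.associated_left q (isSineGordonSolution_omega hg c (by omega) (by omega))
    (isSineGordonSolution_omega hg c le_rfl (by omega)) h, p.stateVec_eq hg c hj⟩

theorem exists_soliton_of_one (hg : GenericParams n lam) (c : ℕ → ℝ) (j : ℕ) (hj : j + 1 ≤ n)
    {x y g : ℝ → ℝ → ℝ} (h : IsSolitonSolution lam c 1 x y g) :
    ∃ x' y' g', IsSolitonSolution lam c (j + 1) x' y' g' ∧
      ∀ ξ η, stateVec x' y' g' ξ η = (prodS lam c j ξ η).mulVec (stateVec x y g ξ η) := by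
  induction j with
  | zero => exact ⟨x, y, g, h, fun ξ η => by rw [prodS, one_mulVec]⟩
  | succ j ih =>
    obtain ⟨x', y', g', h', e'⟩ := ih (by omega)
    obtain ⟨x'', y'', g'', h'', e''⟩ := exists_soliton_succ hg c hj h'
    exact ⟨x'', y'', g'', h'', fun ξ η => by rw [e'', e', prodS, mulVec_mulVec]⟩

theorem exists_one_of_soliton (hg : GenericParams n lam) (c : ℕ → ℝ) (j : ℕ) (hj : j + 1 ≤ n) :
    ∀ {x y g : ℝ → ℝ → ℝ}, IsSolitonSolution lam c (j + 1) x y g →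
    ∃ x' y' g', IsSolitonSolution lam c 1 x' y' g' ∧
      ∀ ξ η, stateVec x y g ξ η = (prodS lam c j ξ η).mulVec (stateVec x' y' g' ξ η) := by
  induction j with
  | zero => exact fun {x y g} h => ⟨x, y, g, h, fun ξ η => by rw [prodS, one_mulVec]⟩
  | succ j ih =>
    intro x y g h
    obtain ⟨x', y', g', h', e'⟩ := exists_soliton_pred hg c hj h
    obtain ⟨x'', y'', g'', h'', e''⟩ := ih (by omega) h'
    exact ⟨x'', y'', g'', h'', fun ξ η => by rw [e', e'', prodS, mulVec_mulVec]⟩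

/-- The explicit one-soliton solution. -/
theorem isSolitonSolution_one (hg : GenericParams n lam) (hn : 1 ≤ n) (c : ℕ → ℝ) (k : ℝ) :
    IsSolitonSolution lam c 1 (x₁ lam c) (y₁ lam k) (g₁ lam c) := by
  have hl := hg.ne_zero 1 le_rfl hn
  have hb := backlund_omega hg c (s := 1) (j := 0) le_rfl (by omega)
  refine ⟨isSineGordonSolution_omega hg c (by omega) (by omega),
    isSineGordonSolution_omega hg c le_rfl (by omega), hb, fun ξ η => ?_, fun ξ η => ?_,
    fun ξ η => ?_, fun ξ η => ?_, fun ξ η => ?_, fun ξ η => ?_, fun ξ η => ?_⟩ <;>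
  have ha := expo_pos lam c 1 ξ η <;>
  have hp : 1 + expo lam c 1 ξ η ^ 2 ≠ 0 := by positivity
  · exact (div_pos (by positivity) (by positivity)).ne'
  all_goals
    simp only [Nat.sub_self, omega_zero, add_zero, sub_zero, sin_omega_one, cos_omega_one,
      g₁, x₁, y₁, add_comm _ (1 : ℝ)]
  · have h := expo_xi lam c 1 ξ η
    refine ((h.const_mul 2).fun_div ((h.fun_pow 2).const_add 1) hp).congr_deriv ?_
    field_simp
    ring
  · have h := expo_eta lam c 1 ξ η
    refine ((h.const_mul 2).fun_div ((h.fun_pow 2).const_add 1) hp).congr_deriv ?_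
    field_simp
    ring
  · have h := expo_xi lam c 1 ξ η
    refine (((h.fun_pow 2).sub_const 1).fun_div ((h.fun_pow 2).const_add 1) hp).congr_deriv ?_
    field_simp
    ring
  · have h := expo_eta lam c 1 ξ η
    refine (((h.fun_pow 2).sub_const 1).fun_div ((h.fun_pow 2).const_add 1) hp).congr_deriv ?_
    field_simp
    ring
  · refine ((((hasDerivAt_id ξ).const_mul (lam 1)).sub_const (η / lam 1)).add_const
      k).congr_deriv ?_
    field_simp
  · refine ((((hasDerivAt_id η).div_const (lam 1)).const_sub (lam 1 * ξ)).add_const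
      k).congr_deriv ?_
    field_simp

end CAE

end

theorem proposition2 (n : ℕ) (hn : 1 ≤ n) (lam c : ℕ → ℝ)
    (hlam : ∀ i, 1 ≤ i → i ≤ n → lam i ≠ 0)
    (hdist : ∀ i j, 1 ≤ i → i < j → j ≤ n → lam i ^ 2 ≠ lam j ^ 2) :
    -- the functions `φ` are well defined and belong to the solitons of the Bianchi lattice
    (∀ s j, 1 ≤ s → s + j ≤ n + 1 → ∀ ξ η : ℝ,
      (CAE.cauchyMatrix lam c s j ξ η).det ≠ 0 ∧
      Real.cos (2 * CAE.omega lam c s j ξ η) = CAE.phi lam c s j ξ η) ∧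
    -- the explicit one-soliton data
    (∀ k₁ : ℝ, CAE.IsSolitonSolution lam c 1
      (CAE.x₁ lam c) (CAE.y₁ lam k₁) (CAE.g₁ lam c)) ∧
    -- the formula turns the explicit one-soliton data into an `n`-soliton solution
    (∀ k₁ : ℝ, ∃ x y g : ℝ → ℝ → ℝ, CAE.IsSolitonSolution lam c n x y g ∧
      ∀ ξ η : ℝ, CAE.stateVec x y g ξ η =
        (CAE.prodS lam c (n - 1) ξ η).mulVec
          (CAE.stateVec (CAE.x₁ lam c) (CAE.y₁ lam k₁) (CAE.g₁ lam c) ξ η)) ∧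
    -- the formula gives exactly the `n`-soliton solutions when all one-soliton data are admitted
    (∀ x y g : ℝ → ℝ → ℝ, CAE.IsSolitonSolution lam c n x y g ↔
      ∃ x' y' g' : ℝ → ℝ → ℝ, CAE.IsSolitonSolution lam c 1 x' y' g' ∧
        ∀ ξ η : ℝ, CAE.stateVec x y g ξ η =
          (CAE.prodS lam c (n - 1) ξ η).mulVec (CAE.stateVec x' y' g' ξ η)) := by
  have hg : CAE.GenericParams n lam := ⟨hlam, hdist⟩
  obtain ⟨m, rfl⟩ : ∃ m, n = m + 1 := ⟨n - 1, by omega⟩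
  refine ⟨fun s j hs hj ξ η => ⟨CAE.det_cauchyMatrix_ne_zero hg c hs hj ξ η,
    CAE.cos_two_mul_omega hg c hs hj ξ η⟩, CAE.isSolitonSolution_one hg hn c,
    fun k₁ => CAE.exists_soliton_of_one hg c m le_rfl (CAE.isSolitonSolution_one hg hn c k₁),
    fun x y g => ⟨CAE.exists_one_of_soliton hg c m le_rfl, ?_⟩⟩
  -- The given triple has the same state vector as the soliton solution constructed from the
  -- one-soliton data, hence coincides with it.
  rintro ⟨x', y', g', h', e'⟩
  obtain ⟨x'', y'', g'', h'', e''⟩ := CAE.exists_soliton_of_one hg c m le_rfl h'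
  obtain ⟨rfl, rfl, rfl⟩ := CAE.stateVec_injective fun ξ η => (e' ξ η).trans (e'' ξ η).symm
  exact h''
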